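/- \textbf{Theorem 2.} \emph{Edge Clique Cover} (ECC) is the following problem: given a finite simple graph $G=(V,E)$ and a nonnegative integer $k$, output a set of at most $k$ cliques of $G$ such that every edge of $G$ is contained in at least one of them, if such a set exists, and NO otherwise. Let $n=|V|$, and let $\beta$ be the clique number of $G$. (a) ECC can be solved in time $2^{\beta k\log_2 k}\,n^{O(1)}$ (where $k\log_2 k$ is read as $0$ for $k=0$): there are a single program of a random access machine (registers and arrays of natural numbers; addition, truncated subtraction, comparison and access to a cell cost one unit each; there is no multiplication) and a constant $c$ such that for all $G$ and $k$ the program, given $n$, $k$ and the adjacency matrix of $G$, halts with a correct output after at most $2^{\beta k\log_2 k}\cdot c\,(n+1)^{c}$ steps. In particular, ECC parameterized by $\beta$ and $k$ is fixed-parameter tractable. (b) The search tree of the algorithm ECCS2 for $(G,k)$ is defined as follows. Fix an ordering $u_1,\dots,u_n$ of $V$ in which every vertex has at most $d$ neighbours that come later, where $d$ is the degeneracy of $G$ (the smallest $d$ such that every nonempty subgraph has a vertex with at most $d$ neighbours in it), and fix a list of the edges of $G$ in which each edge occurs once and the first end points (in the vertex ordering) appear in the order $u_1,\dots,u_n$.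 A node consists of a list of cliques $C_1,\dots,C_q$ and a budget; the root has no cliques and budget $k$. For a vertex $z$ let $R_z=\{l : z\in C_l, \text{ or } z\notin C_l \text{ and all vertices of } C_l \text{ are neighbours of } z\}$. A node whose cliques cover all edges is successful and has no children. Otherwise let $\{x,y\}$ be the last edge in the list that is not covered: the node has one child for each $l\in R_x\cap R_y$, in which $C_l$ is replaced by $C_l\cup\{x,y\}$ and the budget is unchanged, and, if the budget is positive, one further child, in which the clique $C_{q+1}=\{x,y\}$ is added and the budget decreases by one. Then, for all $G$ and $k$, this tree has depth at most $\beta k$ and every node has at most $k$ children; the cliques of a successful node are a solution of $(G,k)$; and if $(G,k)$ has a solution, then the tree has a successful node. -/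

import Mathlib

namespace ECC

/-! ## Random access machines

Programs over finitely many registers and finitely many arrays of natural numbers, every cell of
which is addressable. The only arithmetic is addition, truncated subtraction and comparison (no
multiplication), and every elementary operation costs one time unit. -/

/-- Expressions: constants, registers, array cells (with a computed address), arithmetic. -/
inductive Expr : Type
  | const (c : ℕ)
  | var (i : ℕ)
  | arr (a : ℕ) (e : Expr)
  | add (e f : Expr)
  | sub (e f : Expr)
  | lt (e f : Expr)
  | eq (e f : Expr)

/-- The memory: the content of every register and of every cell of every array. -/
structure State : Type where
  var : ℕ → ℕ
  arr : ℕ → ℕ → ℕ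

/-- The value of an expression; a comparison yields `1` if it holds and `0` otherwise. -/
def Expr.eval (s : State) : Expr → ℕ
  | .const c => c
  | .var i => s.var i
  | .arr a e => s.arr a (e.eval s)
  | .add e f => e.eval s + f.eval s
  | .sub e f => e.eval s - f.eval s
  | .lt e f => if e.eval s < f.eval s then 1 else 0
  | .eq e f => if e.eval s = f.eval s then 1 else 0

/-- The number of elementary operations in the evaluation of an expression. -/
def Expr.cost : Expr → ℕ
  | .const _ => 1
  | .var _ => 1
  | .arr _ e => e.cost + 1
  | .add e f => e.cost + f.cost + 1
  | .sub e f => e.cost + f.cost + 1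
  | .lt e f => e.cost + f.cost + 1
  | .eq e f => e.cost + f.cost + 1

/-- Assignment of a register. -/
def State.setVar (s : State) (i v : ℕ) : State :=
  { s with var := Function.update s.var i v }

/-- Assignment of the cell `p` of the array `a`. -/
def State.setArr (s : State) (a p v : ℕ) : State :=
  { s with arr := Function.update s.arr a (Function.update (s.arr a) p v) }

/-- Programs. In `cond` and `loop` a test succeeds if its value is not `0`. -/
inductive Prog : Type
  | skip
  | assign (i : ℕ) (e : Expr)
  | store (a : ℕ) (p e : Expr)
  | seq (P Q : Prog)
  | cond (b : Expr) (P Q : Prog)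
  | loop (b : Expr) (P : Prog)

/-- `Exec P s t s'`: the program `P`, started in the state `s`, halts after exactly `t` time units,
in the state `s'`. -/
inductive Exec : Prog → State → ℕ → State → Prop
  | skip (s : State) : Exec .skip s 1 s
  | assign (i : ℕ) (e : Expr) (s : State) :
      Exec (.assign i e) s (e.cost + 1) (s.setVar i (e.eval s))
  | store (a : ℕ) (p e : Expr) (s : State) :
      Exec (.store a p e) s (p.cost + e.cost + 1) (s.setArr a (p.eval s) (e.eval s))
  | seq {P Q : Prog} {s s₁ s₂ : State} {t₁ t₂ : ℕ} :
      Exec P s t₁ s₁ → Exec Q s₁ t₂ s₂ → Exec (.seq P Q) s (t₁ + t₂) s₂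
  | cond_true {b : Expr} {P Q : Prog} {s s₁ : State} {t : ℕ} :
      b.eval s ≠ 0 → Exec P s t s₁ → Exec (.cond b P Q) s (b.cost + 1 + t) s₁
  | cond_false {b : Expr} {P Q : Prog} {s s₁ : State} {t : ℕ} :
      b.eval s = 0 → Exec Q s t s₁ → Exec (.cond b P Q) s (b.cost + 1 + t) s₁
  | loop_true {b : Expr} {P : Prog} {s s₁ s₂ : State} {t₁ t₂ : ℕ} :
      b.eval s ≠ 0 → Exec P s t₁ s₁ → Exec (.loop b P) s₁ t₂ s₂ →
      Exec (.loop b P) s (b.cost + 1 + t₁ + t₂) s₂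
  | loop_false {b : Expr} {P : Prog} {s : State} :
      b.eval s = 0 → Exec (.loop b P) s (b.cost + 1) s

/-! ## The problem Edge Clique Cover -/

/-- `𝒞` is a set of at most `k` cliques of `G` such that every edge of `G` is contained in one of
them. -/
def IsSolution {V : Type*} (G : SimpleGraph V) (k : ℕ) (𝒞 : Finset (Finset V)) : Prop :=
  𝒞.card ≤ k ∧ (∀ C ∈ 𝒞, G.IsClique (C : Set V)) ∧
    ∀ x y, G.Adj x y → ∃ C ∈ 𝒞, x ∈ C ∧ y ∈ C

open Classical in
/-- The instance `(G, k)` in memory: register `0` holds the number `n` of vertices, register `1`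
holds `k`, and array `0` holds the `n × n` adjacency matrix, row by row. All else is `0`. -/
noncomputable def input {n : ℕ} (G : SimpleGraph (Fin n)) (k : ℕ) : State where
  var i := if i = 0 then n else if i = 1 then k else 0
  arr a p :=
    if a = 0 ∧ ∃ i j : Fin n, p = (i : ℕ) * n + (j : ℕ) ∧ G.Adj i j then 1 else 0

/-- The answer in memory: NO (here `none`) if register `0` holds `0`; otherwise the family of the
`q` sets of vertices, where `q` is the content of register `1`, whose `q × n` incidence matrix is
held in array `1`, row by row. -/
def output (n : ℕ) (s : State) : Option (Finset (Finset (Fin n))) :=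
  if s.var 0 = 0 then none
  else some ((Finset.range (s.var 1)).image fun l =>
    Finset.univ.filter fun v : Fin n => s.arr 1 (l * n + (v : ℕ)) ≠ 0)

/-- `a` is a correct answer to the instance `(G, k)`: a solution if there is one, and NO
otherwise. -/
def IsCorrect {V : Type*} (G : SimpleGraph V) (k : ℕ) (a : Option (Finset (Finset V))) : Prop :=
  match a with
  | none => ¬ ∃ 𝒞 : Finset (Finset V), IsSolution G k 𝒞
  | some 𝒞 => IsSolution G k 𝒞

/-! ## Degeneracy and degeneracy edge permutations -/

/-- The degeneracy of `G`: the smallest `d` such that every nonempty subgraph has a vertex with at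
most `d` neighbours in the subgraph. -/
noncomputable def degeneracy {V : Type*} (G : SimpleGraph V) : ℕ :=
  sInf {d : ℕ | ∀ H : G.Subgraph, H.verts.Nonempty → ∃ v ∈ H.verts, (H.neighborSet v).ncard ≤ d}

/-- The ordering `u 0, u 1, …, u (n - 1)` of the vertices is a degeneracy ordering: each vertex has
at most `degeneracy G` neighbours that come later. -/
def IsDegeneracyOrdering {V : Type*} {n : ℕ} (G : SimpleGraph V) (u : Fin n ≃ V) : Prop :=
  ∀ x, {y | G.Adj x y ∧ u.symm x < u.symm y}.ncard ≤ degeneracy G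

/-- `π` is a degeneracy edge permutation for the ordering `u`: it lists every edge exactly once, as
a pair `(x, y)` in which `y` comes after `x`, and the first end points come in the order `u`. -/
def IsDEP {V : Type*} {n : ℕ} (G : SimpleGraph V) (u : Fin n ≃ V) (π : List (V × V)) : Prop :=
  π.Nodup ∧ (∀ x y, (x, y) ∈ π ↔ G.Adj x y ∧ u.symm x < u.symm y) ∧
    π.Pairwise fun e f => u.symm e.1 ≤ u.symm f.1

/-! ## The search tree of the algorithm ECCS2 -/

/-- A node of the search tree: the list of the cliques constructed so far, and the number of
cliques that may still be created. -/
structure Node (V : Type*) where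
  cliques : List (Finset V)
  budget : ℕ

/-- The edge `e = {x, y}` is covered by one of the cliques of the node. -/
def Node.Covers {V : Type*} (ν : Node V) (e : V × V) : Prop :=
  ∃ C ∈ ν.cliques, e.1 ∈ C ∧ e.2 ∈ C

/-- The clique `C` is a representative of the vertex `x`. -/
def IsRepresentative {V : Type*} (G : SimpleGraph V) (C : Finset V) (x : V) : Prop :=
  x ∈ C ∨ (x ∉ C ∧ ∀ z ∈ C, G.Adj x z)

open Classical in
/-- The representative set `R_x` of the vertex `x` at a node: the indices of its representatives.
These sets, for all vertices `x`, are the implicit set representation. -/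
noncomputable def Node.repSet {V : Type*} (G : SimpleGraph V) (ν : Node V) (x : V) : Finset ℕ :=
  (Finset.range ν.cliques.length).filter fun l => ∃ C ∈ ν.cliques[l]?, IsRepresentative G C x

open Classical in
/-- The last uncovered edge of `π`, if there is one. -/
noncomputable def Node.lastUncovered {V : Type*} (π : List (V × V)) (ν : Node V) :
    Option (V × V) :=
  π.reverse.find? fun e => ¬ ν.Covers e

open Classical in
/-- The branches at a node with last uncovered edge `{x, y}`: one for each `l ∈ R_x ∩ R_y`, in
which `x` and `y` are included in the clique with index `l`, and then, if the budget permits, one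
in which `{x, y}` becomes a new clique. There is none if all edges are covered. -/
noncomputable def Node.branches {V : Type*} [DecidableEq V] (G : SimpleGraph V) (π : List (V × V))
    (ν : Node V) : List (Node V) :=
  match ν.lastUncovered π with
  | none => []
  | some (x, y) =>
      (((ν.repSet G x ∩ ν.repSet G y).sort (· ≤ ·)).map fun l =>
        ⟨ν.cliques.modify l fun C => C ∪ {x, y}, ν.budget⟩) ++
      (if 0 < ν.budget then [⟨ν.cliques ++ [{x, y}], ν.budget - 1⟩] else [])

/-- `InTree G π k h ν`: the search tree of ECCS2 for the instance `(G, k)`, with the edges in the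
order `π`, has the node `ν` at depth `h`. At the root no clique has been constructed. This is the
full tree, of which a run of ECCS2, depth first, visits the part before its first success. -/
inductive InTree {V : Type*} [DecidableEq V] (G : SimpleGraph V) (π : List (V × V)) (k : ℕ) :
    ℕ → Node V → Prop
  | root : InTree G π k 0 ⟨[], k⟩
  | branch {h : ℕ} {ν μ : Node V} :
      InTree G π k h ν → μ ∈ ν.branches G π → InTree G π k (h + 1) μ

/-- All edges of `G` are covered at the node, so that the search stops there with success. -/
def Node.IsSuccess {V : Type*} (G : SimpleGraph V) (ν : Node V) : Prop :=
  ∀ x y, G.Adj x y → ν.Covers (x, y)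

end ECC

/-!
The depth of the search tree of ECCS2 is bounded by the total size of the cliques at a node: each
branch includes at least one new vertex in a clique, or creates a clique with two vertices, and at
most `k` cliques with at most `β` vertices each are ever created (`InTree.invariant`,
`InTree.depth_le`). The tree contains a success if there is a solution, because a node whose cliques
lie in distinct members of the solution is successful or has a child of the same kind
(`Node.Extends.exists_branch`). Only the fact that `π` lists every edge is needed for this.

The random access machine uses a variant of this search that needs no stack. Let `k` be at most
`n * n`, which is no restriction as the edges themselves form a solution. A string of digits below
`k` guides one pass over all pairs of vertices, in which `k` cliques grow from the empty set: when
the pass meets an edge that is not covered, the next digit says in which clique its end points are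
to be included, and the pass fails if that set is not a clique (`pass`). As coverage is never lost,
a pass without failure ends with a solution, and suitable digits turn any solution into such a pass
(`exists_pass_ok`). Each digit consumed enlarges a clique, so at most `β k` digits are consumed, and
a failure occurs among the first `β k + 1` digits (`pass_i_le_cliqueNum_mul`).

The program tries the strings in lexicographic order. After a failure at position `i` it increments
the digit at this position and clears the later ones, which skips only strings that fail in the same
way (`digitValue_increment_le`). The value of the first `β k + 1` digits to the base `k` increases
from pass to pass, so there are at most `k ^ (β k + 1)` passes, each of polynomial length. The
machine does not have to know `β`: this bound occurs only in the analysis (`runs_searchLoop`).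
The base is `max k 1` rather than `k`, to include the case `k = 0`.
-/

namespace ECC

/-! ### Extending a clique by an edge -/

section Clique

variable {V : Type*} [DecidableEq V] {G : SimpleGraph V}

lemma isClique_union_pair {C : Finset V} {x y : V} (hC : G.IsClique (C : Set V))
    (hxy : G.Adj x y) (hx : ∀ v ∈ C, v = x ∨ G.Adj x v) (hy : ∀ v ∈ C, v = y ∨ G.Adj y v) :
    G.IsClique ((C ∪ {x, y} : Finset V) : Set V) := by
  have h : ((C ∪ {x, y} : Finset V) : Set V) = insert x (insert y (C : Set V)) := by
    ext v; simp
  rw [h, SimpleGraph.isClique_insert, SimpleGraph.isClique_insert]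
  refine ⟨⟨hC, fun v hv hne => (hy v hv).resolve_left (Ne.symm hne)⟩, fun v hv hne => ?_⟩
  rcases hv with rfl | hv
  · exact hxy
  · exact (hx v hv).resolve_left (Ne.symm hne)

lemma card_lt_card_union_pair {C : Finset V} {x y : V} (h : ¬ (x ∈ C ∧ y ∈ C)) :
    C.card < (C ∪ {x, y}).card := by
  refine Finset.card_lt_card ⟨Finset.subset_union_left, fun hs => h ⟨?_, ?_⟩⟩ <;>
  exact hs (by simp)

end Clique

/-! ### The search tree of ECCS2 -/

section SearchTree

variable {V : Type*} {G : SimpleGraph V} {π : List (V × V)} {k n : ℕ} {u : Fin n ≃ V}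

lemma IsDEP.mem_or_mem (hπ : IsDEP G u π) {x y : V} (h : G.Adj x y) :
    (x, y) ∈ π ∨ (y, x) ∈ π := by
  rcases lt_trichotomy (u.symm x) (u.symm y) with hlt | heq | hgt
  · exact .inl ((hπ.2.1 x y).2 ⟨h, hlt⟩)
  · exact absurd (u.symm.injective heq) h.ne
  · exact .inr ((hπ.2.1 y x).2 ⟨h.symm, hgt⟩)

lemma Node.isSuccess_of_lastUncovered_eq_none (hπ : IsDEP G u π) {ν : Node V}
    (h : ν.lastUncovered π = none) : ν.IsSuccess G := by
  intro x y hxy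
  simp only [Node.lastUncovered, List.find?_eq_none, List.mem_reverse, decide_eq_true_eq,
    not_not] at h
  rcases hπ.mem_or_mem hxy with hm | hm
  · exact h _ hm
  · obtain ⟨C, hC, h₁, h₂⟩ := h _ hm
    exact ⟨C, hC, h₂, h₁⟩

lemma Node.of_lastUncovered_eq_some (hπ : IsDEP G u π) {ν : Node V} {x y : V}
    (h : ν.lastUncovered π = some (x, y)) : G.Adj x y ∧ ¬ ν.Covers (x, y) := by
  classical
  refine ⟨((hπ.2.1 x y).1 ?_).1, ?_⟩
  · simpa using List.mem_of_find?_eq_some h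
  · simpa [Node.lastUncovered] using List.find?_some h

lemma IsRepresentative.eq_or_adj {C : Finset V} {x v : V} (h : IsRepresentative G C x)
    (hC : G.IsClique (C : Set V)) (hv : v ∈ C) : v = x ∨ G.Adj x v := by
  rcases h with hx | ⟨-, hx⟩
  · by_cases hvx : v = x
    · exact .inl hvx
    · exact .inr (hC hx hv (Ne.symm hvx))
  · exact .inr (hx v hv)

lemma IsRepresentative.of_subset {C D : Finset V} {x : V} (hD : G.IsClique (D : Set V))
    (hCD : C ⊆ D) (hx : x ∈ D) : IsRepresentative G C x := by
  by_cases hxC : x ∈ C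
  · exact .inl hxC
  · exact .inr ⟨hxC, fun z hz => hD hx (hCD hz) fun h => hxC (h ▸ hz)⟩

lemma Node.mem_repSet {ν : Node V} {x : V} {l : ℕ} :
    l ∈ ν.repSet G x ↔ ∃ C, ν.cliques[l]? = some C ∧ IsRepresentative G C x := by
  classical
  simp only [Node.repSet, Finset.mem_filter, Finset.mem_range, Option.mem_def]
  refine ⟨fun h => h.2, fun ⟨C, hC, h⟩ => ⟨(List.getElem?_eq_some_iff.1 hC).1, C, hC, h⟩⟩

variable [DecidableEq V]

/-- The children of a node: either an edge is included in one of its cliques, or a new clique is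
created. -/
lemma Node.mem_branches {ν μ : Node V} : μ ∈ ν.branches G π ↔ ∃ x y,
    ν.lastUncovered π = some (x, y) ∧
      ((∃ l ∈ ν.repSet G x ∩ ν.repSet G y,
          μ = ⟨ν.cliques.modify l fun C => C ∪ {x, y}, ν.budget⟩) ∨
        (0 < ν.budget ∧ μ = ⟨ν.cliques ++ [{x, y}], ν.budget - 1⟩)) := by
  unfold Node.branches
  split
  case h_1 h => simp [h]
  case h_2 x y h =>
    rw [List.mem_append, List.mem_map]
    constructor
    · rintro (⟨l, hl, rfl⟩ | hμ)
      · exact ⟨x, y, h, .inl ⟨l, by simpa using hl, by congr!⟩⟩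
      · split at hμ
        case isTrue hb => exact ⟨x, y, h, .inr ⟨hb, by simpa using hμ⟩⟩
        case isFalse => simp at hμ
    · rintro ⟨x', y', h', hμ⟩
      obtain ⟨rfl, rfl⟩ : x = x' ∧ y = y' := by simpa [h] using h'
      rcases hμ with ⟨l, hl, rfl⟩ | ⟨hb, rfl⟩
      · exact .inl ⟨l, by simpa using hl, by congr!⟩
      · exact .inr (by simp [hb])

lemma Node.length_branches_le {ν : Node V} :
    (ν.branches G π).length ≤ ν.cliques.length + ν.budget := by
  classical
  unfold Node.branches
  split
  · simp
  · rename_i x y _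
    rw [List.length_append, List.length_map, Finset.length_sort]
    gcongr
    · refine (Finset.card_le_card Finset.inter_subset_left).trans ?_
      exact (Finset.card_filter_le _ _).trans (Finset.card_range _).le
    · split <;> simp; omega

/-- The invariant of the search tree. The total size of the cliques grows along every branch, which
bounds the depth. -/
lemma InTree.invariant (hπ : IsDEP G u π) {h : ℕ} {ν : Node V} (hν : InTree G π k h ν) :
    (∀ C ∈ ν.cliques, G.IsClique (C : Set V)) ∧ ν.cliques.length + ν.budget = k ∧
      h ≤ (ν.cliques.map Finset.card).sum := by
  induction hν with
  | root => simp
  | @branch h ν μ _ hμ ih =>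
    obtain ⟨hcl, hlen, hsum⟩ := ih
    obtain ⟨x, y, hxy, hμ⟩ := Node.mem_branches.1 hμ
    obtain ⟨hadj, hunc⟩ := Node.of_lastUncovered_eq_some hπ hxy
    rcases hμ with ⟨l, hl, rfl⟩ | ⟨hb, rfl⟩
    · obtain ⟨hlx, hly⟩ := Finset.mem_inter.1 hl
      obtain ⟨C, hC, hCx⟩ := Node.mem_repSet.1 hlx
      obtain ⟨C', hC', hCy⟩ := Node.mem_repSet.1 hly
      obtain rfl : C = C' := by simpa [hC] using hC'
      obtain ⟨hlt, hCl⟩ := List.getElem?_eq_some_iff.1 hC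
      obtain ⟨l₁, A, l₂, h₁, h₂, h₃⟩ :=
        List.exists_of_modify (fun C : Finset V => C ∪ {x, y}) hlt
      obtain rfl : A = C := by simpa [h₁, ← h₂] using hCl
      have hA : A ∈ ν.cliques := by simp [h₁]
      have hlt := card_lt_card_union_pair (C := A) (x := x) (y := y) fun h => hunc ⟨A, hA, h⟩
      refine ⟨fun D hD => ?_, by simpa using hlen, ?_⟩
      · simp only [h₃, List.mem_append, List.mem_cons] at hD
        rcases hD with hD | rfl | hD
        · exact hcl D (by simp [h₁, hD])
        · exact isClique_union_pair (hcl A hA) hadj (fun v => hCx.eq_or_adj (hcl A hA))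
            (fun v => hCy.eq_or_adj (hcl A hA))
        · exact hcl D (by simp [h₁, hD])
      · rw [h₃]
        rw [h₁] at hsum
        simp only [List.map_append, List.map_cons, List.sum_append, List.sum_cons] at hsum ⊢
        omega
    · refine ⟨fun D hD => ?_, by simp; omega, ?_⟩
      · simp only [List.mem_append, List.mem_singleton] at hD
        rcases hD with hD | rfl
        · exact hcl D hD
        · simpa [SimpleGraph.isClique_pair] using fun _ => hadj
      · simp [hadj.ne]; omega

lemma InTree.depth_le [Finite V] (hπ : IsDEP G u π) {h : ℕ} {ν : Node V}
    (hν : InTree G π k h ν) : h ≤ G.cliqueNum * k := by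
  obtain ⟨hcl, hlen, hsum⟩ := hν.invariant hπ
  have h₁ : (ν.cliques.map Finset.card).sum ≤ ν.cliques.length * G.cliqueNum := by
    have := List.sum_le_card_nsmul (ν.cliques.map Finset.card) G.cliqueNum (by
      simp only [List.mem_map]
      rintro _ ⟨C, hC, rfl⟩
      exact SimpleGraph.IsClique.card_le_cliqueNum (tc := hcl C hC))
    simpa using this
  have h₂ : ν.cliques.length * G.cliqueNum ≤ k * G.cliqueNum := by gcongr; omega
  rw [mul_comm]
  omega

lemma InTree.isSolution (hπ : IsDEP G u π) {h : ℕ} {ν : Node V}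
    (hν : InTree G π k h ν) (hs : ν.IsSuccess G) : IsSolution G k ν.cliques.toFinset := by
  obtain ⟨hcl, hlen, -⟩ := hν.invariant hπ
  refine ⟨(List.toFinset_card_le _).trans (by omega), by simpa using hcl, fun x y hxy => ?_⟩
  simpa [Node.Covers] using hs x y hxy

/-- The node can be completed to the solution `𝒞`: its cliques are contained in pairwise distinct
members of `𝒞`. -/
def Node.Extends (ν : Node V) (𝒞 : Finset (Finset V)) : Prop :=
  ∃ f : ℕ → Finset V, Set.InjOn f (Set.Iio ν.cliques.length) ∧
    ∀ l C, ν.cliques[l]? = some C → f l ∈ 𝒞 ∧ C ⊆ f l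

/-- From a node that can be completed to a solution, a branch leads to another such node, or the
node is successful. -/
lemma Node.Extends.exists_branch (hπ : IsDEP G u π) {𝒞 : Finset (Finset V)}
    (h𝒞 : IsSolution G k 𝒞) {ν : Node V} (hk : ν.cliques.length + ν.budget = k)
    (hν : ν.Extends 𝒞) : ν.IsSuccess G ∨ ∃ μ ∈ ν.branches G π, μ.Extends 𝒞 := by
  obtain ⟨f, hinj, hf⟩ := hν
  rcases hlast : ν.lastUncovered π with _ | ⟨x, y⟩
  · exact .inl (Node.isSuccess_of_lastUncovered_eq_none hπ hlast)
  right
  obtain ⟨hadj, -⟩ := Node.of_lastUncovered_eq_some hπ hlast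
  obtain ⟨D, hD, hxD, hyD⟩ := h𝒞.2.2 x y hadj
  have hpair : ({x, y} : Finset V) ⊆ D := by
    intro v hv
    simp only [Finset.mem_insert, Finset.mem_singleton] at hv
    rcases hv with rfl | rfl <;> assumption
  by_cases hDf : ∃ l < ν.cliques.length, f l = D
  · obtain ⟨l, hl, rfl⟩ := hDf
    have hC := List.getElem?_eq_getElem hl
    obtain ⟨-, hsub⟩ := hf l _ hC
    refine ⟨_, Node.mem_branches.2 ⟨x, y, hlast, .inl ⟨l, Finset.mem_inter.2 ⟨?_, ?_⟩, rfl⟩⟩,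
      f, by simpa using hinj, fun j C hj => ?_⟩
    · exact Node.mem_repSet.2 ⟨_, hC, .of_subset (h𝒞.2.1 _ hD) hsub hxD⟩
    · exact Node.mem_repSet.2 ⟨_, hC, .of_subset (h𝒞.2.1 _ hD) hsub hyD⟩
    · rw [List.getElem?_modify] at hj
      obtain ⟨A, hA, hAC⟩ := Option.map_eq_some_iff.1 hj
      obtain ⟨h₁, h₂⟩ := hf j A hA
      refine ⟨h₁, ?_⟩
      split at hAC
      case isTrue h => subst h; subst hAC; exact Finset.union_subset h₂ hpair
      case isFalse h => subst hAC; exact h₂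
  · push Not at hDf
    have hmem : ∀ l < ν.cliques.length, f l ∈ 𝒞 := fun l hl =>
      (hf l _ (List.getElem?_eq_getElem hl)).1
    -- The new clique is available: `D` is a member of `𝒞` that is not in use yet.
    have hlt : ν.cliques.length < k := by
      have hss : (Finset.range ν.cliques.length).image f ⊂ 𝒞 := by
        refine Finset.ssubset_iff_subset_ne.2 ⟨?_, ?_⟩
        · simpa [Finset.image_subset_iff] using hmem
        · rintro heq
          rw [← heq] at hD
          simp only [Finset.mem_image, Finset.mem_range] at hD
          obtain ⟨l, hl, h⟩ := hD
          exact hDf l hl h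
      have := Finset.card_lt_card hss
      rw [Finset.card_image_of_injOn (by simpa using hinj), Finset.card_range] at this
      exact this.trans_le h𝒞.1
    refine ⟨_, Node.mem_branches.2 ⟨x, y, hlast, .inr ⟨by omega, rfl⟩⟩,
      Function.update f ν.cliques.length D, ?_, fun j C hj => ?_⟩
    · intro i hi j hj hij
      simp only [List.length_append, List.length_singleton, Set.mem_Iio, Nat.lt_succ_iff_lt_or_eq]
        at hi hj
      rcases hi with hi | rfl <;> rcases hj with hj | rfl
      · rw [Function.update_of_ne hi.ne, Function.update_of_ne hj.ne] at hij
        exact hinj hi hj hij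
      · rw [Function.update_of_ne hi.ne, Function.update_self] at hij
        exact absurd hij (hDf i hi)
      · rw [Function.update_of_ne hj.ne, Function.update_self] at hij
        exact absurd hij.symm (hDf j hj)
      · rfl
    · rcases lt_trichotomy j ν.cliques.length with hlj | rfl | hlj
      · rw [Function.update_of_ne hlj.ne]
        exact hf j C (by simpa [List.getElem?_append_left hlj] using hj)
      · rw [Function.update_self]
        obtain rfl : {x, y} = C := by simpa using hj
        exact ⟨hD, hpair⟩
      · have := (List.getElem?_eq_some_iff.1 hj).1
        simp at this
        omega

lemma InTree.exists_isSuccess [Finite V] (hπ : IsDEP G u π) {𝒞 : Finset (Finset V)}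
    (h𝒞 : IsSolution G k 𝒞) : ∃ h ν, InTree G π k h ν ∧ ν.IsSuccess G := by
  have key : ∀ m h ν, InTree G π k h ν → ν.Extends 𝒞 → G.cliqueNum * k ≤ h + m →
      ∃ h ν, InTree G π k h ν ∧ ν.IsSuccess G := by
    intro m
    induction m with
    | zero =>
      intro h ν hν hE hle
      rcases hE.exists_branch hπ h𝒞 (hν.invariant hπ).2.1 with hs | ⟨μ, hμ, -⟩
      · exact ⟨h, ν, hν, hs⟩
      · have := (hν.branch hμ).depth_le hπ
        omega
    | succ m ih =>
      intro h ν hν hE hle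
      rcases hE.exists_branch hπ h𝒞 (hν.invariant hπ).2.1 with hs | ⟨μ, hμ, hμE⟩
      · exact ⟨h, ν, hν, hs⟩
      · exact ih (h + 1) μ (hν.branch hμ) hμE (by omega)
  exact key (G.cliqueNum * k) 0 _ .root ⟨fun _ => ∅, by simp, by simp⟩ (by omega)

end SearchTree

/-! ### A pass over the edges, guided by a string of digits -/

/-- The state of a pass over the edges: the current cliques `C 0, C 1, …`, the number of digits
consumed so far, and whether the pass has not failed yet. -/
structure Pass (V : Type*) where
  C : ℕ → Finset V
  i : ℕ
  ok : Bool

section Pass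

variable {V : Type*} [DecidableEq V] {G : SimpleGraph V} {k : ℕ} {D E : ℕ → ℕ}

open Classical in
/-- The treatment of a pair `e` in a pass. If it is an edge which none of the first `k` cliques
covers, then the next digit names the clique in which its end points are included. The pass fails,
without consuming the digit, if this is not the name of one of the first `k` cliques or does not
give a clique. -/
noncomputable def Pass.step (G : SimpleGraph V) (k : ℕ) (D : ℕ → ℕ) (σ : Pass V) (e : V × V) :
    Pass V :=
  if σ.ok = true ∧ G.Adj e.1 e.2 ∧ ∀ l < k, ¬ (e.1 ∈ σ.C l ∧ e.2 ∈ σ.C l) then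
    if D σ.i < k ∧ ∀ v ∈ σ.C (D σ.i), (v = e.1 ∨ G.Adj e.1 v) ∧ (v = e.2 ∨ G.Adj e.2 v) then
      ⟨Function.update σ.C (D σ.i) (σ.C (D σ.i) ∪ {e.1, e.2}), σ.i + 1, true⟩
    else ⟨σ.C, σ.i, false⟩
  else σ

/-- The result of a pass over the list `es` of pairs, with the digits `D`. All cliques are empty
at the start. -/
noncomputable def pass (G : SimpleGraph V) (k : ℕ) (D : ℕ → ℕ) (es : List (V × V)) : Pass V :=
  es.foldl (Pass.step G k D) ⟨fun _ => ∅, 0, true⟩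

lemma pass_nil : pass G k D [] = ⟨fun _ => ∅, 0, true⟩ := rfl

lemma pass_concat (es : List (V × V)) (e : V × V) :
    pass G k D (es ++ [e]) = (pass G k D es).step G k D e := by
  simp [pass]

lemma Pass.step_of_skip {σ : Pass V} {e : V × V}
    (h : ¬ (σ.ok = true ∧ G.Adj e.1 e.2 ∧ ∀ l < k, ¬ (e.1 ∈ σ.C l ∧ e.2 ∈ σ.C l))) :
    σ.step G k D e = σ := by
  rw [Pass.step, if_neg h]

lemma Pass.step_of_extend {σ : Pass V} {e : V × V}
    (h : σ.ok = true ∧ G.Adj e.1 e.2 ∧ ∀ l < k, ¬ (e.1 ∈ σ.C l ∧ e.2 ∈ σ.C l))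
    (h' : D σ.i < k ∧ ∀ v ∈ σ.C (D σ.i), (v = e.1 ∨ G.Adj e.1 v) ∧ (v = e.2 ∨ G.Adj e.2 v)) :
    σ.step G k D e =
      ⟨Function.update σ.C (D σ.i) (σ.C (D σ.i) ∪ {e.1, e.2}), σ.i + 1, true⟩ := by
  rw [Pass.step, if_pos h, if_pos h']

lemma Pass.step_of_fail {σ : Pass V} {e : V × V}
    (h : σ.ok = true ∧ G.Adj e.1 e.2 ∧ ∀ l < k, ¬ (e.1 ∈ σ.C l ∧ e.2 ∈ σ.C l))
    (h' : ¬ (D σ.i < k ∧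
      ∀ v ∈ σ.C (D σ.i), (v = e.1 ∨ G.Adj e.1 v) ∧ (v = e.2 ∨ G.Adj e.2 v))) :
    σ.step G k D e = ⟨σ.C, σ.i, false⟩ := by
  rw [Pass.step, if_pos h, if_neg h']

lemma pass_i_le_length (es : List (V × V)) : (pass G k D es).i ≤ es.length := by
  induction es using List.reverseRecOn with
  | nil => simp [pass_nil]
  | append_singleton es e ih =>
    rw [pass_concat, List.length_append, List.length_singleton]
    unfold Pass.step
    split_ifs
    · exact Nat.succ_le_succ ih
    · exact Nat.le_succ_of_le ih
    · exact Nat.le_succ_of_le ih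

lemma pass_isClique (es : List (V × V)) (l : ℕ) : G.IsClique ((pass G k D es).C l : Set V) := by
  induction es using List.reverseRecOn with
  | nil => simp [pass_nil]
  | append_singleton es e ih =>
    rw [pass_concat]
    unfold Pass.step
    split_ifs with h h'
    · by_cases hl : l = D (pass G k D es).i
      · subst hl
        simp only [Function.update_self]
        exact isClique_union_pair ih h.2.1 (fun v hv => (h'.2 v hv).1) (fun v hv => (h'.2 v hv).2)
      · simpa only [Function.update_of_ne hl] using ih
    · exact ih
    · exact ih

/-- Each consumed digit has enlarged one of the cliques. -/
lemma pass_i_le_sum (es : List (V × V)) :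
    (pass G k D es).i ≤ ∑ l ∈ Finset.range k, ((pass G k D es).C l).card := by
  induction es using List.reverseRecOn with
  | nil => simp [pass_nil]
  | append_singleton es e ih =>
    rw [pass_concat]
    unfold Pass.step
    split_ifs with h h'
    · refine Nat.succ_le_of_lt (ih.trans_lt (Finset.sum_lt_sum (fun l _ => ?_)
        ⟨D (pass G k D es).i, Finset.mem_range.2 h'.1, ?_⟩)) <;> dsimp only
      · by_cases hl : l = D (pass G k D es).i
        · subst hl
          rw [Function.update_self]
          exact Finset.card_le_card Finset.subset_union_left
        · rw [Function.update_of_ne hl]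
      · rw [Function.update_self]
        exact card_lt_card_union_pair (h.2.2 _ h'.1)
    · exact ih
    · exact ih

lemma pass_i_le_cliqueNum_mul [Finite V] (es : List (V × V)) :
    (pass G k D es).i ≤ G.cliqueNum * k := by
  refine (pass_i_le_sum es).trans ?_
  have := Finset.sum_le_card_nsmul (Finset.range k) (fun l => ((pass G k D es).C l).card)
    G.cliqueNum fun l _ => SimpleGraph.IsClique.card_le_cliqueNum (tc := pass_isClique es l)
  simpa [mul_comm] using this

/-- A pass that does not fail covers all the edges it treats. -/
lemma exists_mem_of_pass_ok {es : List (V × V)} (h : (pass G k D es).ok = true) :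
    ∀ e ∈ es, G.Adj e.1 e.2 →
      ∃ l < k, e.1 ∈ (pass G k D es).C l ∧ e.2 ∈ (pass G k D es).C l := by
  induction es using List.reverseRecOn with
  | nil => simp
  | append_singleton es e ih =>
    rw [pass_concat] at h ⊢
    by_cases h₁ : (pass G k D es).ok = true ∧ G.Adj e.1 e.2 ∧
        ∀ l < k, ¬ (e.1 ∈ (pass G k D es).C l ∧ e.2 ∈ (pass G k D es).C l)
    · by_cases h₂ : D (pass G k D es).i < k ∧ ∀ v ∈ (pass G k D es).C (D (pass G k D es).i),
          (v = e.1 ∨ G.Adj e.1 v) ∧ (v = e.2 ∨ G.Adj e.2 v)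
      · rw [Pass.step_of_extend h₁ h₂]
        intro f hf hadj
        rw [List.mem_append, List.mem_singleton] at hf
        dsimp only
        rcases hf with hf | rfl
        · obtain ⟨l, hl, hx, hy⟩ := ih h₁.1 f hf hadj
          refine ⟨l, hl, ?_⟩
          by_cases hld : l = D (pass G k D es).i
          · subst hld
            rw [Function.update_self]
            exact ⟨Finset.mem_union_left _ hx, Finset.mem_union_left _ hy⟩
          · rw [Function.update_of_ne hld]
            exact ⟨hx, hy⟩
        · exact ⟨_, h₂.1, by simp⟩
      · rw [Pass.step_of_fail h₁ h₂] at h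
        simp at h
    · rw [Pass.step_of_skip h₁] at h ⊢
      intro f hf hadj
      rw [List.mem_append, List.mem_singleton] at hf
      rcases hf with hf | rfl
      · exact ih h f hf hadj
      · by_contra hcon
        push Not at hcon
        exact h₁ ⟨h, hadj, fun l hl hm => hcon l hl hm.1 hm.2⟩

/-- A pass depends only on the digits that it has consumed and, if it fails, on the one at which
it fails. -/
lemma pass_congr {es : List (V × V)} (h : ∀ j < (pass G k D es).i, D j = E j)
    (h' : (pass G k D es).ok = false → D (pass G k D es).i = E (pass G k D es).i) :
    pass G k E es = pass G k D es := by
  induction es using List.reverseRecOn with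
  | nil => rfl
  | append_singleton es e ih =>
    rw [pass_concat] at h h' ⊢
    rw [pass_concat]
    by_cases h₁ : (pass G k D es).ok = true ∧ G.Adj e.1 e.2 ∧
        ∀ l < k, ¬ (e.1 ∈ (pass G k D es).C l ∧ e.2 ∈ (pass G k D es).C l)
    · by_cases h₂ : D (pass G k D es).i < k ∧ ∀ v ∈ (pass G k D es).C (D (pass G k D es).i),
          (v = e.1 ∨ G.Adj e.1 v) ∧ (v = e.2 ∨ G.Adj e.2 v)
      · rw [Pass.step_of_extend h₁ h₂] at h h' ⊢
        have hi := h _ (Nat.lt_succ_self _)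
        rw [ih (fun j hj => h j (Nat.lt_succ_of_lt hj)) (by simp [h₁.1])]
        rw [hi] at h₂ ⊢
        rw [Pass.step_of_extend h₁ h₂]
      · rw [Pass.step_of_fail h₁ h₂] at h h' ⊢
        have hi := h' rfl
        dsimp only at hi
        rw [ih h (by simp [h₁.1])]
        rw [hi] at h₂
        rw [Pass.step_of_fail h₁ h₂]
    · rw [Pass.step_of_skip h₁] at h h' ⊢
      rw [ih h h', Pass.step_of_skip h₁]

/-- If `k` cliques cover the edges, then some digits, smaller than `K`, lead to a pass that does
not fail: name for each uncovered edge one of these cliques that contains it. The bound `k ≤ K`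
allows for `k = 0`, where no string of digits below `k` exists. -/
lemma exists_pass_ok {K : ℕ} (hK : 0 < K) (hkK : k ≤ K) {S : ℕ → Finset V}
    (hS : ∀ l < k, G.IsClique (S l : Set V))
    (hcov : ∀ x y, G.Adj x y → ∃ l < k, x ∈ S l ∧ y ∈ S l) (es : List (V × V)) :
    ∃ D : ℕ → ℕ, (∀ j, D j < K) ∧ (pass G k D es).ok = true := by
  suffices ∃ D : ℕ → ℕ, (∀ j, D j < K) ∧ (pass G k D es).ok = true ∧
      ∀ l < k, (pass G k D es).C l ⊆ S l by
    obtain ⟨D, h₁, h₂, -⟩ := this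
    exact ⟨D, h₁, h₂⟩
  induction es using List.reverseRecOn with
  | nil => exact ⟨fun _ => 0, fun _ => hK, by simp [pass_nil], by simp [pass_nil]⟩
  | append_singleton es e ih =>
    obtain ⟨D, hD, hok, hsub⟩ := ih
    by_cases h₁ : (pass G k D es).ok = true ∧ G.Adj e.1 e.2 ∧
        ∀ l < k, ¬ (e.1 ∈ (pass G k D es).C l ∧ e.2 ∈ (pass G k D es).C l)
    · obtain ⟨d, hd, hx, hy⟩ := hcov _ _ h₁.2.1
      set i := (pass G k D es).i with hi
      have hcongr : pass G k (Function.update D i d) es = pass G k D es :=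
        pass_congr (fun j hj => by rw [Function.update_of_ne (by omega)]) (by simp [hok])
      have hadj : ∀ z ∈ S d, ∀ v ∈ (pass G k D es).C d, v = z ∨ G.Adj z v := by
        intro z hz v hv
        by_cases hvz : v = z
        · exact .inl hvz
        · exact .inr (hS d hd hz (hsub d hd hv) (Ne.symm hvz))
      refine ⟨Function.update D i d, fun j => ?_, ?_⟩
      · by_cases hj : j = i
        · subst hj; rw [Function.update_self]; omega
        · rw [Function.update_of_ne hj]; exact hD j
      · rw [pass_concat, hcongr, Pass.step_of_extend h₁]
        · refine ⟨rfl, fun l hl => ?_⟩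
          rw [← hi, Function.update_self]
          dsimp only
          by_cases hld : l = d
          · subst hld
            rw [Function.update_self]
            refine Finset.union_subset (hsub l hl) fun v hv => ?_
            simp only [Finset.mem_insert, Finset.mem_singleton] at hv
            rcases hv with rfl | rfl <;> assumption
          · rw [Function.update_of_ne hld]
            exact hsub l hl
        · rw [← hi, Function.update_self]
          exact ⟨hd, fun v hv => ⟨hadj _ hx v hv, hadj _ hy v hv⟩⟩
    · refine ⟨D, hD, ?_⟩
      rw [pass_concat, Pass.step_of_skip h₁]
      exact ⟨hok, hsub⟩

end Pass

/-! ### Strings of digits in lexicographic order -/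

/-- The number with the digits `D 0, …, D (m - 1)` to the base `K`, most significant digit first.
Digits that are not smaller than `K` are allowed. -/
def digitValue (K : ℕ) (D : ℕ → ℕ) : ℕ → ℕ
  | 0 => 0
  | m + 1 => K * digitValue K D m + D m

section DigitValue

variable {K : ℕ} {D E : ℕ → ℕ}

lemma digitValue_congr {m : ℕ} (h : ∀ j < m, D j = E j) :
    digitValue K D m = digitValue K E m := by
  induction m with
  | zero => rfl
  | succ m ih =>
    rw [digitValue, digitValue, ih fun j hj => h j (by omega), h m (by omega)]

lemma digitValue_add_congr {a : ℕ} (h : digitValue K D a = digitValue K E a)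
    (h' : ∀ j, a ≤ j → D j = E j) (m : ℕ) : digitValue K D (a + m) = digitValue K E (a + m) := by
  induction m with
  | zero => exact h
  | succ m ih => rw [← add_assoc, digitValue, digitValue, ih, h' _ (by omega)]

lemma pow_mul_digitValue_le (a m : ℕ) : K ^ m * digitValue K D a ≤ digitValue K D (a + m) := by
  induction m with
  | zero => simp
  | succ m ih =>
    rw [← add_assoc, digitValue, pow_succ]
    calc K ^ m * K * digitValue K D a = K * (K ^ m * digitValue K D a) := by ring
      _ ≤ K * digitValue K D (a + m) := by gcongr
      _ ≤ _ := by omega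

lemma digitValue_lt (hD : ∀ j, D j < K) (a m : ℕ) :
    digitValue K D (a + m) < K ^ m * (digitValue K D a + 1) := by
  induction m with
  | zero => simp
  | succ m ih =>
    rw [← add_assoc, digitValue, pow_succ]
    calc K * digitValue K D (a + m) + D (a + m) < K * (digitValue K D (a + m) + 1) := by
          rw [mul_add, mul_one]; have := hD (a + m); omega
      _ ≤ K * (K ^ m * (digitValue K D a + 1)) := by gcongr; omega
      _ = _ := by ring

lemma digitValue_of_zero {a : ℕ} (h : ∀ j, a ≤ j → D j = 0) (m : ℕ) :
    digitValue K D (a + m) = K ^ m * digitValue K D a := by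
  induction m with
  | zero => simp
  | succ m ih => rw [← add_assoc, digitValue, ih, h _ (by omega)]; ring

lemma eq_of_digitValue_eq (hD : ∀ j, D j < K) (hE : ∀ j, E j < K) {m : ℕ}
    (h : digitValue K D m = digitValue K E m) : ∀ j < m, D j = E j := by
  induction m with
  | zero => simp
  | succ m ih =>
    rw [digitValue, digitValue] at h
    have hm : D m = E m := by
      have := congrArg (· % K) h
      simpa [Nat.mod_eq_of_lt (hD m), Nat.mod_eq_of_lt (hE m)] using this
    have hK : 0 < K := (Nat.zero_le _).trans_lt (hD 0)
    have hv : digitValue K D m = digitValue K E m :=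
      Nat.eq_of_mul_eq_mul_left hK (by omega)
    intro j hj
    rcases Nat.lt_succ_iff_lt_or_eq.1 hj with hj | rfl
    · exact ih hv j hj
    · exact hm

lemma digitValue_increment_succ {i : ℕ} {D' : ℕ → ℕ} (hlt : ∀ j < i, D' j = D j)
    (heq : D' i = D i + 1) : digitValue K D' (i + 1) = digitValue K D (i + 1) + 1 := by
  rw [digitValue, digitValue, digitValue_congr hlt, heq, add_assoc]

lemma digitValue_lt_increment {i T : ℕ} {D' : ℕ → ℕ} (hi : i < T) (hlt : ∀ j < i, D' j = D j)
    (heq : D' i = D i + 1) (hgt : ∀ j, i < j → D' j = 0) (hD : ∀ j, D j < K) :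
    digitValue K D T < digitValue K D' T := by
  obtain ⟨m, rfl⟩ := Nat.exists_eq_add_of_le (Nat.succ_le_of_lt hi)
  rw [digitValue_of_zero (fun j hj => hgt j hj), digitValue_increment_succ hlt heq]
  exact digitValue_lt hD _ _

/-- After an increment at position `i` one has skipped only strings that share the digits up to
this position. -/
lemma digitValue_increment_le {i T : ℕ} {D' : ℕ → ℕ} (hi : i < T) (hlt : ∀ j < i, D' j = D j)
    (heq : D' i = D i + 1) (hgt : ∀ j, i < j → D' j = 0) (hD : ∀ j, D j < K) (hE : ∀ j, E j < K)
    (hle : digitValue K D T ≤ digitValue K E T) (hne : ∃ j ≤ i, D j ≠ E j) :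
    digitValue K D' T ≤ digitValue K E T := by
  obtain ⟨m, rfl⟩ := Nat.exists_eq_add_of_le (Nat.succ_le_of_lt hi)
  rw [digitValue_of_zero (fun j hj => hgt j hj), digitValue_increment_succ hlt heq]
  refine le_trans ?_ (pow_mul_digitValue_le (i + 1) m)
  gcongr
  refine Nat.succ_le_of_lt (lt_of_le_of_ne ?_ fun h => ?_)
  · by_contra hcon
    have h₁ := digitValue_lt hE (i + 1) m
    have h₂ : K ^ m * (digitValue K E (i + 1) + 1) ≤ K ^ m * digitValue K D (i + 1) := by
      gcongr; omega
    exact absurd (hle.trans_lt (h₁.trans_le (h₂.trans (pow_mul_digitValue_le (i + 1) m))))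
      (lt_irrefl _)
  · obtain ⟨j, hj, hjne⟩ := hne
    exact hjne (eq_of_digitValue_eq hD hE h j (by omega))

/-- A carry does not change the value. -/
lemma digitValue_carry {i T : ℕ} (hi : i + 1 < T) (hDi : D (i + 1) = K) {D' : ℕ → ℕ}
    (h₀ : D' (i + 1) = 0) (h₁ : D' i = D i + 1) (h : ∀ j, j ≠ i → j ≠ i + 1 → D' j = D j) :
    digitValue K D' T = digitValue K D T := by
  obtain ⟨m, rfl⟩ := Nat.exists_eq_add_of_le (Nat.succ_le_of_lt hi)
  refine digitValue_add_congr ?_ (fun j hj => h j (by omega) (by omega)) m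
  rw [digitValue, digitValue, digitValue, digitValue, h₀, h₁, hDi,
    digitValue_congr (fun j hj => h j (by omega) (by omega))]
  ring

end DigitValue

/-! ### A calculus for programs and their running time -/

@[simp] lemma State.setVar_var (s : State) (i v j : ℕ) :
    (s.setVar i v).var j = if j = i then v else s.var j := by
  simp [State.setVar, Function.update_apply]

@[simp] lemma State.setVar_arr (s : State) (i v : ℕ) : (s.setVar i v).arr = s.arr := rfl

@[simp] lemma State.setArr_var (s : State) (a p v : ℕ) : (s.setArr a p v).var = s.var := rfl

@[simp] lemma State.setArr_arr (s : State) (a p v b : ℕ) :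
    (s.setArr a p v).arr b = if b = a then Function.update (s.arr a) p v else s.arr b := by
  simp [State.setArr, Function.update_apply]

@[simp] lemma State.setVar_setVar (s : State) (i v w : ℕ) :
    (s.setVar i v).setVar i w = s.setVar i w := by
  simp [State.setVar]

/-- Started in the state `s`, the program halts after at most `B` time units, in a state that
satisfies `Q`. -/
def Runs (P : Prog) (s : State) (B : ℕ) (Q : State → Prop) : Prop :=
  ∃ t s', Exec P s t s' ∧ t ≤ B ∧ Q s'

section Runs

variable {P P' : Prog} {s : State} {b e e' : Expr} {B B' B₁ B₂ : ℕ} {Q R : State → Prop}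

lemma Runs.mono (h : Runs P s B Q) (hB : B ≤ B') (hQ : ∀ s', Q s' → R s') : Runs P s B' R := by
  obtain ⟨t, s', h₁, h₂, h₃⟩ := h
  exact ⟨t, s', h₁, h₂.trans hB, hQ _ h₃⟩

lemma Runs.skip (hB : 1 ≤ B) (hQ : Q s) : Runs .skip s B Q := ⟨1, s, .skip s, hB, hQ⟩

lemma Runs.assign {i : ℕ} (hB : e.cost + 1 ≤ B) (hQ : Q (s.setVar i (e.eval s))) :
    Runs (.assign i e) s B Q := ⟨_, _, .assign i e s, hB, hQ⟩

lemma Runs.store {a : ℕ} (hB : e.cost + e'.cost + 1 ≤ B)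
    (hQ : Q (s.setArr a (e.eval s) (e'.eval s))) : Runs (.store a e e') s B Q :=
  ⟨_, _, .store a e e' s, hB, hQ⟩

lemma Runs.seq (h : Runs P s B₁ R) (h' : ∀ s', R s' → Runs P' s' B₂ Q) (hB : B₁ + B₂ ≤ B) :
    Runs (.seq P P') s B Q := by
  obtain ⟨t₁, s₁, h₁, h₂, h₃⟩ := h
  obtain ⟨t₂, s₂, h₁', h₂', h₃'⟩ := h' s₁ h₃
  exact ⟨_, s₂, .seq h₁ h₁', by omega, h₃'⟩

lemma Runs.assign_seq {i : ℕ} (h : Runs P (s.setVar i (e.eval s)) B₁ Q)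
    (hB : e.cost + 1 + B₁ ≤ B) : Runs (.seq (.assign i e) P) s B Q :=
  Runs.seq (R := fun s' => s' = s.setVar i (e.eval s)) (.assign le_rfl rfl)
    (by rintro _ rfl; exact h) hB

lemma Runs.store_seq {a : ℕ} (h : Runs P (s.setArr a (e.eval s) (e'.eval s)) B₁ Q)
    (hB : e.cost + e'.cost + 1 + B₁ ≤ B) : Runs (.seq (.store a e e') P) s B Q :=
  Runs.seq (R := fun s' => s' = s.setArr a (e.eval s) (e'.eval s)) (.store le_rfl rfl)
    (by rintro _ rfl; exact h) hB

lemma Runs.cond (h : b.eval s ≠ 0 → Runs P s B₁ Q) (h' : b.eval s = 0 → Runs P' s B₁ Q)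
    (hB : b.cost + 1 + B₁ ≤ B) : Runs (.cond b P P') s B Q := by
  by_cases hb : b.eval s = 0
  · obtain ⟨t, s', h₁, h₂, h₃⟩ := h' hb
    exact ⟨_, s', .cond_false hb h₁, by omega, h₃⟩
  · obtain ⟨t, s', h₁, h₂, h₃⟩ := h hb
    exact ⟨_, s', .cond_true hb h₁, by omega, h₃⟩

/-- A loop with the invariant `I`, whose first argument bounds the number of rounds to come. -/
lemma Runs.loop {I : ℕ → State → Prop} {r : ℕ} (h₀ : I r s)
    (h : ∀ r s, I r s → b.eval s ≠ 0 → Runs P s B (fun s' => ∃ r' < r, I r' s')) :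
    Runs (.loop b P) s (r * (b.cost + 1 + B) + (b.cost + 1))
      (fun s' => b.eval s' = 0 ∧ ∃ r', I r' s') := by
  induction r using Nat.strong_induction_on generalizing s with
  | _ r ih =>
    by_cases hb : b.eval s = 0
    · exact ⟨_, s, .loop_false hb, by omega, hb, r, h₀⟩
    · obtain ⟨t₁, s₁, h₁, ht₁, r', hr', hI⟩ := h r s h₀ hb
      obtain ⟨t₂, s₂, h₂, ht₂, hQ⟩ := ih r' hr' hI
      refine ⟨_, s₂, .loop_true hb h₁ h₂, ?_, hQ⟩
      have : (r' + 1) * (b.cost + 1 + B) ≤ r * (b.cost + 1 + B) := by gcongr; omega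
      rw [add_mul, one_mul] at this
      omega

/-- A loop with exactly `N` rounds; `I p` holds after `p` rounds. -/
lemma Runs.forLoop {I : ℕ → State → Prop} (N : ℕ) (h₀ : I 0 s)
    (hb : ∀ p s, p ≤ N → I p s → (b.eval s ≠ 0 ↔ p < N))
    (h : ∀ p s, p < N → I p s → Runs P s B (I (p + 1))) :
    Runs (.loop b P) s (N * (b.cost + 1 + B) + (b.cost + 1)) (I N) := by
  have h₁ := Runs.loop (b := b) (P := P) (B := B) (s := s) (r := N)
    (I := fun r s => r ≤ N ∧ I (N - r) s) ⟨le_rfl, by simpa using h₀⟩ (by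
      rintro r s ⟨hr, hI⟩ hne
      have hlt := (hb _ s (by omega) hI).1 hne
      refine (h _ s hlt hI).mono le_rfl fun s' hs' => ⟨r - 1, by omega, by omega, ?_⟩
      rwa [show N - (r - 1) = N - r + 1 by omega])
  refine h₁.mono le_rfl ?_
  rintro s' ⟨hz, r, hr, hI⟩
  have hnot := mt (hb _ s' (by omega) hI).2 (by simpa using hz)
  rwa [show N - r = N by omega] at hI

end Runs

/-- Linear search: register `l` receives the first value below register `b` for which the test `e`
succeeds, or the content of register `b` if there is none. The conjunction of two tests with values
in `{0, 1}` is expressed by `1 <` their sum, here and below. -/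
def searchProg (l b : ℕ) (e : Expr) : Prog :=
  .seq (.assign l (.const 0))
    (.loop (.lt (.const 1) (.add (.lt (.var l) (.var b)) (.eq e (.const 0))))
      (.assign l (.add (.var l) (.const 1))))

lemma runs_searchProg {l b : ℕ} (hlb : b ≠ l) (e : Expr) (s : State) :
    Runs (searchProg l b e) s (s.var b * (e.cost + 13) + e.cost + 11) (fun s' =>
      ∃ m ≤ s.var b, s' = s.setVar l m ∧ (∀ j < m, e.eval (s.setVar l j) = 0) ∧
        (m < s.var b → e.eval (s.setVar l m) ≠ 0)) := by
  refine Runs.assign_seq (Runs.mono (Runs.loop (B := 4) (r := s.var b) (I := fun r s' =>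
    ∃ m, m + r = s.var b ∧ s' = s.setVar l m ∧ ∀ j < m, e.eval (s.setVar l j) = 0) ?_ ?_)
    le_rfl ?_) ?_
  · exact ⟨0, by simp, by simp [Expr.eval], by simp⟩
  · rintro r _ ⟨m, hm, rfl, hj⟩ hne
    refine Runs.assign (by simp [Expr.cost]) ?_
    simp only [Expr.eval, State.setVar_var, hlb, if_true, if_false] at hne
    have hlt : m < s.var b ∧ e.eval (s.setVar l m) = 0 := by grind
    refine ⟨r - 1, by omega, m + 1, by omega, by simp [Expr.eval], fun j hjm => ?_⟩
    rcases Nat.lt_succ_iff_lt_or_eq.1 hjm with h | rfl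
    · exact hj j h
    · exact hlt.2
  · rintro s' ⟨hz, r, m, hm, rfl, hj⟩
    refine ⟨m, by omega, rfl, hj, fun hlt hcon => ?_⟩
    simp [Expr.eval, hlb, hlt, hcon] at hz
  · simp only [Expr.cost]
    ring_nf
    omega

/-! ### The program for a pass -/

/-- The entry of the clique in register `l` and the vertex in register `v` in the incidence matrix
of the cliques. -/
def incAt (l v : ℕ) : Expr := .arr 1 (.add (.arr 2 (.var l)) (.var v))

/-- The vertex in register `9` is equal or adjacent to the vertex in register `x`. -/
def nearExpr (x : ℕ) : Expr :=
  .add (.eq (.var 9) (.var x)) (.arr 0 (.add (.arr 2 (.var x)) (.var 9)))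

/-- The clique in register `9` contains the vertices in the registers `7` and `8`. -/
def coveredExpr : Expr := .eq (.add (incAt 9 7) (incAt 9 8)) (.const 2)

/-- The vertex in register `9` lies in the clique in register `10`, but is not both near the vertex
in register `7` and near the one in register `8`. All four summands have values in `{0, 1}`: the sum
on the right is `0` or `2`, and the one on the left is `2` if the vertex is near both. -/
def obstacleExpr : Expr :=
  .lt (.add (nearExpr 7) (nearExpr 8)) (.add (incAt 10 9) (incAt 10 9))

/-- The program for `Pass.step`, applied to the pair in the registers `7` and `8`, whose position
in the adjacency matrix is in register `6`. -/
def stepProg : Prog :=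
  .cond (.lt (.const 1) (.add (.var 5) (.arr 0 (.var 6))))
    (.seq (searchProg 9 1 coveredExpr)
      (.cond (.lt (.var 9) (.var 1)) .skip
        (.seq (.assign 10 (.arr 3 (.var 4)))
          (.seq (searchProg 9 0 obstacleExpr)
            (.cond (.lt (.const 1) (.add (.lt (.var 10) (.var 1)) (.eq (.var 9) (.var 0))))
              (.seq (.store 1 (.add (.arr 2 (.var 10)) (.var 7)) (.const 1))
                (.seq (.store 1 (.add (.arr 2 (.var 10)) (.var 8)) (.const 1))
                  (.assign 4 (.add (.var 4) (.const 1)))))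
              (.assign 5 (.const 0)))))))
    .skip

open Classical in
/-- The data that a pass does not change: the instance in the registers `0` and `1` and array `0`,
the number of pairs of vertices in register `2`, the base of the digits in register `3`, and the
multiples of `n` in array `2`. -/
structure Base {n : ℕ} (G : SimpleGraph (Fin n)) (k K : ℕ) (s : State) : Prop where
  n_eq : s.var 0 = n
  k_eq : s.var 1 = k
  sq_eq : s.var 2 = n * n
  base_eq : s.var 3 = K
  adj_eq : ∀ x y : Fin n, s.arr 0 ((x : ℕ) * n + (y : ℕ)) = if G.Adj x y then 1 else 0
  mul_eq : ∀ j ≤ n * n, s.arr 2 j = j * n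

/-- The state `σ` of a pass is held in memory: the incidence matrix of its first `k` cliques in
array `1`, the number of consumed digits in register `4`, and the success flag in register `5`. -/
structure Shows {n : ℕ} (k : ℕ) (σ : Pass (Fin n)) (s : State) : Prop where
  inc_eq : ∀ l < k, ∀ v : Fin n, s.arr 1 (l * n + (v : ℕ)) = if v ∈ σ.C l then 1 else 0
  i_eq : s.var 4 = σ.i
  ok_eq : s.var 5 = if σ.ok then 1 else 0

lemma mul_add_inj {n l l' : ℕ} {v v' : Fin n} (h : l * n + (v : ℕ) = l' * n + (v' : ℕ)) :
    l = l' ∧ v = v' := by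
  have hn : 0 < n := v.pos
  have h₁ := congrArg (· / n) h
  simp only [mul_comm _ n, Nat.mul_add_div hn, Nat.div_eq_of_lt v.isLt,
    Nat.div_eq_of_lt v'.isLt, add_zero] at h₁
  subst h₁
  exact ⟨rfl, Fin.ext (by omega)⟩

section

variable {n : ℕ} {G : SimpleGraph (Fin n)} {k K : ℕ} {s s' : State}

lemma Base.congr (h : Base G k K s) (hv : ∀ i < 4, s'.var i = s.var i) (h₀ : s'.arr 0 = s.arr 0)
    (h₂ : s'.arr 2 = s.arr 2) : Base G k K s' where
  n_eq := by rw [hv 0 (by omega), h.n_eq]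
  k_eq := by rw [hv 1 (by omega), h.k_eq]
  sq_eq := by rw [hv 2 (by omega), h.sq_eq]
  base_eq := by rw [hv 3 (by omega), h.base_eq]
  adj_eq := by rw [h₀]; exact h.adj_eq
  mul_eq := by rw [h₂]; exact h.mul_eq

lemma Base.setVar (h : Base G k K s) {i : ℕ} (hi : 4 ≤ i) (v : ℕ) : Base G k K (s.setVar i v) :=
  h.congr (fun j hj => by simp; omega) rfl rfl

lemma Base.setArr (h : Base G k K s) {a : ℕ} (ha : a ≠ 0) (ha' : a ≠ 2) (p v : ℕ) :
    Base G k K (s.setArr a p v) :=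
  h.congr (fun j _ => rfl) (by simp [ha.symm]) (by simp [ha'.symm])

lemma Base.eval_incAt (h : Base G k K s) {σ : Pass (Fin n)} (hσ : Shows k σ s)
    (hk : k ≤ n * n) {l v : ℕ} {w : Fin n} (hl : s.var l < k) (hv : s.var v = w) :
    (incAt l v).eval s = if w ∈ σ.C (s.var l) then 1 else 0 := by
  simp only [incAt, Expr.eval, h.mul_eq _ (hl.le.trans hk), hv, hσ.inc_eq _ hl]

open Classical in
lemma Base.eval_nearExpr (h : Base G k K s) {x : ℕ} {v w : Fin n} (hv : s.var 9 = v)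
    (hw : s.var x = w) : (nearExpr x).eval s = if v = w ∨ G.Adj w v then 1 else 0 := by
  have hle : (w : ℕ) ≤ n * n := w.isLt.le.trans (Nat.le_mul_self n)
  simp only [nearExpr, Expr.eval, hv, hw, h.mul_eq _ hle, h.adj_eq, Fin.val_inj]
  by_cases hvw : v = w
  · subst hvw; simp
  · simp [hvw]

lemma Shows.setVar {σ : Pass (Fin n)} (h : Shows k σ s) {i : ℕ} (hi : 6 ≤ i) (v : ℕ) :
    Shows k σ (s.setVar i v) where
  inc_eq := h.inc_eq
  i_eq := by simp [show 4 ≠ i by omega, h.i_eq]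
  ok_eq := by simp [show 5 ≠ i by omega, h.ok_eq]

lemma runs_stepProg (hk : k ≤ n * n) (hs : Base G k K s) {D : ℕ → ℕ} (hD : s.arr 3 = D)
    {σ : Pass (Fin n)} (hσ : Shows k σ s) {x y : Fin n} (hp : s.var 6 = x * n + y)
    (hx : s.var 7 = x) (hy : s.var 8 = y) :
    Runs stepProg s (26 * k + 44 * n + 200) (fun s' => Base G k K s' ∧ s'.arr 3 = D ∧
      Shows k (σ.step G k D (x, y)) s' ∧ ∀ i ∈ [6, 7, 8], s'.var i = s.var i) := by
  classical
  have hadj := hs.adj_eq x y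
  refine Runs.cond (B₁ := 26 * k + 44 * n + 190) (fun hne => ?_) (fun hz => ?_)
    (by simp [Expr.cost]; omega)
  swap
  · refine Runs.skip (by omega) ⟨hs, hD, ?_, fun _ _ => rfl⟩
    rw [Pass.step_of_skip]
    · exact hσ
    · rintro ⟨h₁, h₂, -⟩
      simp [Expr.eval, hp, hadj, hσ.ok_eq, h₁, h₂] at hz
  have hok : σ.ok = true ∧ G.Adj x y := by
    simp only [Expr.eval, hp, hadj, hσ.ok_eq] at hne
    grind
  refine Runs.seq (runs_searchProg (by omega) _ s) (B₂ := 44 * n + 150) ?_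
    (by simp [coveredExpr, incAt, Expr.cost, hs.k_eq]; omega)
  rintro _ ⟨m, hm, rfl, hlt, hfound⟩
  rw [hs.k_eq] at hm hfound
  have hcov : ∀ l < k, coveredExpr.eval (s.setVar 9 l) ≠ 0 ↔ x ∈ σ.C l ∧ y ∈ σ.C l := by
    intro l hl
    have h₁ := (hs.setVar (by omega) l).eval_incAt (hσ.setVar (i := 9) (by omega) l) hk
      (l := 9) (v := 7) (w := x) (by simpa using hl) (by simpa using hx)
    have h₂ := (hs.setVar (by omega) l).eval_incAt (hσ.setVar (i := 9) (by omega) l) hk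
      (l := 9) (v := 8) (w := y) (by simpa using hl) (by simpa using hy)
    simp only [State.setVar_var, if_true] at h₁ h₂
    simp only [coveredExpr, Expr.eval, h₁, h₂]
    grind
  refine Runs.cond (B₁ := 44 * n + 140) (fun hne => ?_) (fun hz => ?_) (by simp [Expr.cost]; omega)
  · have hmk : m < k := by
      by_contra hcon
      simp [Expr.eval, hs.k_eq, hcon] at hne
    refine Runs.skip (by omega)
      ⟨hs.setVar (by omega) m, hD, ?_, by simp⟩
    rw [Pass.step_of_skip]
    · exact hσ.setVar (by omega) m
    · rintro ⟨-, -, h⟩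
      exact h m hmk ((hcov m hmk).1 (hfound hmk))
  obtain rfl : m = k := by
    refine le_antisymm hm (not_lt.1 fun hcon => ?_)
    simp [Expr.eval, hs.k_eq, hcon] at hz
  have h₁ : σ.ok = true ∧ G.Adj x y ∧ ∀ l < m, ¬ (x ∈ σ.C l ∧ y ∈ σ.C l) :=
    ⟨hok.1, hok.2, fun l hl hmem => (hcov l hl).2 hmem (hlt l hl)⟩
  refine Runs.assign_seq (B₁ := 44 * n + 136) ?_ (by simp [Expr.cost]; omega)
  set d := D σ.i with hd
  have hdval : (Expr.arr 3 (.var 4)).eval (s.setVar 9 m) = d := by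
    simp [Expr.eval, hD, hσ.i_eq, hd]
  rw [hdval]
  set s₁ := (s.setVar 9 m).setVar 10 d with hs₁
  have hb₁ : Base G m K s₁ := (hs.setVar (by omega) m).setVar (by omega) d
  have hσ₁ : Shows m σ s₁ := (hσ.setVar (by omega) m).setVar (by omega) d
  refine Runs.seq (runs_searchProg (by omega) _ s₁) (B₂ := 50) ?_
    (by simp [obstacleExpr, nearExpr, incAt, Expr.cost, hb₁.n_eq]; omega)
  rintro _ ⟨r, hr, rfl, hlt', hfound'⟩
  rw [hb₁.n_eq] at hr hfound'
  have hobs : d < m → ∀ v : Fin n, obstacleExpr.eval (s₁.setVar 9 v) ≠ 0 ↔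
      v ∈ σ.C d ∧ ¬ ((v = x ∨ G.Adj x v) ∧ (v = y ∨ G.Adj y v)) := by
    intro hdm v
    have hb₂ := hb₁.setVar (i := 9) (by omega) v
    have e₁ := hb₂.eval_nearExpr (x := 7) (v := v) (w := x) (by simp) (by simp [hs₁, hx])
    have e₂ := hb₂.eval_nearExpr (x := 8) (v := v) (w := y) (by simp) (by simp [hs₁, hy])
    have e₃ := hb₂.eval_incAt (hσ₁.setVar (i := 9) (by omega) v) hk (l := 10) (v := 9) (w := v)
      (by simpa [hs₁] using hdm) (by simp)
    simp only [hs₁, State.setVar_var] at e₃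
    simp only [obstacleExpr, Expr.eval, hs₁, e₃]
    grind
  have hiff : (d < m ∧ r = n) ↔ d < m ∧
      ∀ v ∈ σ.C d, (v = x ∨ G.Adj x v) ∧ (v = y ∨ G.Adj y v) := by
    refine and_congr_right fun hdm => ⟨?_, fun h => ?_⟩
    · rintro rfl v hv
      by_contra hcon
      exact (hobs hdm v).2 ⟨hv, hcon⟩ (hlt' v v.isLt)
    · by_contra hcon
      have hrn : r < n := by omega
      obtain ⟨hm₁, hm₂⟩ := (hobs hdm ⟨r, hrn⟩).1 (hfound' hrn)
      exact hm₂ (h _ hm₁)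
  set s₂ := s₁.setVar 9 r with hs₂
  have hb₂ : Base G m K s₂ := hb₁.setVar (by omega) r
  have hσ₂ : Shows m σ s₂ := hσ₁.setVar (by omega) r
  have hD₂ : s₂.arr 3 = D := hD
  have htest : (Expr.lt (.const 1) (.add (.lt (.var 10) (.var 1)) (.eq (.var 9) (.var 0)))).eval
      s₂ ≠ 0 ↔ d < m ∧ r = n := by
    have e₁ : s₂.var 10 = d := by simp [hs₂, hs₁]
    have e₂ : s₂.var 9 = r := by simp [hs₂]
    simp only [Expr.eval, e₁, e₂, hb₂.k_eq, hb₂.n_eq]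
    grind
  refine Runs.cond (B₁ := 40) (fun hne => ?_) (fun hz => ?_) (by simp [Expr.cost])
  · have hdm := (htest.1 hne).1
    have h₂ := hiff.1 (htest.1 hne)
    have ea : s₂.arr 2 d = d * n := hb₂.mul_eq d (hdm.le.trans hk)
    have e10 : s₂.var 10 = d := by simp [hs₂, hs₁]
    have e7 : s₂.var 7 = x := by simp [hs₂, hs₁, hx]
    have e8 : s₂.var 8 = y := by simp [hs₂, hs₁, hy]
    refine Runs.store_seq (B₁ := 30) (Runs.store_seq (B₁ := 10) (Runs.assign ?_ ?_) ?_) ?_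
    · simp [Expr.cost]
    · refine ⟨((hb₂.setArr (by omega) (by omega) _ _).setArr (by omega) (by omega) _ _).setVar
        (by omega) _, hD₂, ?_, ?_⟩
      · rw [Pass.step_of_extend h₁ h₂]
        refine ⟨fun l hl v => ?_, ?_, ?_⟩
        · simp only [Expr.eval, State.setVar_arr, State.setArr_arr, State.setArr_var, if_true,
            e10, ea, e7, e8, Function.update_apply, hσ₂.inc_eq l hl, show (2 : ℕ) ≠ 1 by omega,
            if_false]
          by_cases hld : l = d
          · subst hld
            simp only [Nat.add_left_cancel_iff, Fin.val_inj, if_true, Finset.mem_union,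
              Finset.mem_insert, Finset.mem_singleton, ← hd]
            grind
          · have hne₁ : ∀ w : Fin n, l * n + (v : ℕ) ≠ d * n + (w : ℕ) :=
              fun w h => hld (mul_add_inj h).1
            simp [hne₁, hld, ← hd]
        · simp [Expr.eval, hσ₂.i_eq]
        · simpa [h₁.1] using hσ₂.ok_eq
      · simp [hs₁, hs₂]
    · simp [Expr.cost]
    · simp [Expr.cost]
  · have h₂ := mt hiff.2 (mt htest.2 (by simpa using hz))
    refine Runs.assign (by simp [Expr.cost]) ⟨hb₂.setVar (by omega) _, hD₂, ?_, ?_⟩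
    · rw [Pass.step_of_fail h₁ h₂]
      exact ⟨hσ₂.inc_eq, by simp [hσ₂.i_eq], by simp [Expr.eval]⟩
    · simp [hs₁, hs₂]

end

/-- All pairs of vertices, in the order of the rows of the adjacency matrix. -/
def pairs (n : ℕ) : List (Fin n × Fin n) := List.ofFn fun q : Fin (n * n) => (q.divNat, q.modNat)

lemma length_pairs (n : ℕ) : (pairs n).length = n * n := by simp [pairs]

lemma mem_pairs {n : ℕ} (e : Fin n × Fin n) : e ∈ pairs n :=
  (List.mem_ofFn' _ _).2 ⟨finProdFinEquiv e, finProdFinEquiv.symm_apply_apply e⟩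

lemma take_succ_pairs {n p : ℕ} (hp : p < n * n) : ∃ x y : Fin n, (x : ℕ) = p / n ∧
    (y : ℕ) = p % n ∧ (pairs n).take (p + 1) = (pairs n).take p ++ [(x, y)] := by
  refine ⟨(⟨p, hp⟩ : Fin (n * n)).divNat, (⟨p, hp⟩ : Fin (n * n)).modNat, rfl, rfl, ?_⟩
  rw [← List.take_concat_get' (pairs n) p (by rwa [length_pairs])]
  simp [pairs]

/-- The program for a pass over all pairs of vertices: clear the incidence matrix, and then treat
the pairs one by one, with their coordinates in the registers `7` and `8`. -/
def passProg : Prog :=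
  .seq (.assign 6 (.const 0))
    (.seq (.loop (.lt (.var 6) (.arr 2 (.var 1)))
        (.seq (.store 1 (.var 6) (.const 0)) (.assign 6 (.add (.var 6) (.const 1)))))
      (.seq (.assign 4 (.const 0)) (.seq (.assign 5 (.const 1)) (.seq (.assign 6 (.const 0))
        (.seq (.assign 7 (.const 0)) (.seq (.assign 8 (.const 0))
          (.loop (.lt (.var 6) (.var 2))
            (.seq stepProg
              (.seq (.assign 6 (.add (.var 6) (.const 1)))
                (.seq (.assign 8 (.add (.var 8) (.const 1)))
                  (.cond (.eq (.var 8) (.var 0))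
                    (.seq (.assign 8 (.const 0)) (.assign 7 (.add (.var 7) (.const 1))))
                    .skip)))))))))))

/-- The program that replaces the string of digits in array `3` by the next one that does not share
with it the digits up to the position in register `4`: the digit there is incremented, the later
ones are cleared, and the carries are propagated. -/
def advanceProg : Prog :=
  .seq (.store 3 (.var 4) (.add (.arr 3 (.var 4)) (.const 1)))
    (.seq (.assign 6 (.add (.var 4) (.const 1)))
      (.seq (.loop (.lt (.var 6) (.add (.var 2) (.const 1)))
          (.seq (.store 3 (.var 6) (.const 0)) (.assign 6 (.add (.var 6) (.const 1)))))
        (.loop (.lt (.const 1) (.add (.lt (.const 0) (.var 4)) (.eq (.arr 3 (.var 4)) (.var 3))))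
          (.seq (.store 3 (.var 4) (.const 0))
            (.seq (.assign 4 (.sub (.var 4) (.const 1)))
              (.store 3 (.var 4) (.add (.arr 3 (.var 4)) (.const 1))))))))

section

variable {n : ℕ} {G : SimpleGraph (Fin n)} {k K : ℕ} {s : State} {D : ℕ → ℕ}

lemma runs_passProg (hk : k ≤ n * n) (hs : Base G k K s) (hD : s.arr 3 = D) :
    Runs passProg s (12 * (k * n) + n * n * (26 * k + 44 * n + 230) + 30) (fun s' =>
      Base G k K s' ∧ s'.arr 3 = D ∧ Shows k (pass G k D (pairs n)) s') := by
  refine Runs.assign_seq (Runs.seq (R := fun s' => Base G k K s' ∧ s'.arr 3 = D ∧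
    ∀ j < k * n, s'.arr 1 j = 0) ((Runs.forLoop (B := 7) (k * n) (I := fun p s' =>
      Base G k K s' ∧ s'.arr 3 = D ∧ s'.var 6 = p ∧ ∀ j < p, s'.arr 1 j = 0) ?_ ?_ ?_).mono
      le_rfl fun s' h => ⟨h.1, h.2.1, h.2.2.2⟩) (fun s₁ hs₁ => ?_)
      (B₂ := n * n * (26 * k + 44 * n + 230) + 20) ?_) ?_
    (B₁ := 12 * (k * n) + n * n * (26 * k + 44 * n + 230) + 28)
  · exact ⟨hs.setVar (by omega) _, hD, by simp [Expr.eval], by simp⟩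
  · rintro p s' - ⟨hb, -, h6, -⟩
    simp [Expr.eval, h6, hb.k_eq, hb.mul_eq k hk]
  · rintro p s' - ⟨hb, h3, h6, h1⟩
    refine Runs.store_seq (B₁ := 4) (Runs.assign (by simp [Expr.cost]) ⟨?_, ?_, ?_, ?_⟩)
      (by simp [Expr.cost])
    · exact (hb.setArr (by omega) (by omega) _ _).setVar (by omega) _
    · simpa using h3
    · simp [Expr.eval, h6]
    · intro j hj
      simp only [Expr.eval, State.setVar_arr, State.setArr_arr, if_true, Function.update_apply, h6]
      split_ifs
      · rfl
      · exact h1 j (by omega)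
  · obtain ⟨hb, h3, h1⟩ := hs₁
    refine Runs.assign_seq (Runs.assign_seq (Runs.assign_seq (Runs.assign_seq (Runs.assign_seq
      ((Runs.forLoop (B := 26 * k + 44 * n + 220) (n * n) (I := fun p s' =>
        Base G k K s' ∧ s'.arr 3 = D ∧ Shows k (pass G k D ((pairs n).take p)) s' ∧
          s'.var 6 = p ∧ s'.var 7 = p / n ∧ s'.var 8 = p % n) ?_ ?_ ?_).mono le_rfl ?_)
      le_rfl) le_rfl) le_rfl) le_rfl) ?_
    · refine ⟨((((hb.setVar ?_ _).setVar ?_ _).setVar ?_ _).setVar ?_ _).setVar ?_ _, h3,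
        ⟨fun l hl v => ?_, ?_, ?_⟩, ?_⟩
      iterate 5 omega
      · have hlt : l * n + (v : ℕ) < k * n := by
          have : (l + 1) * n ≤ k * n := by gcongr; omega
          rw [add_mul, one_mul] at this
          omega
        simpa [pass_nil] using h1 _ hlt
      · simp [Expr.eval, pass_nil]
      · simp [Expr.eval, pass_nil]
      · simp [Expr.eval]
    · rintro p s' - ⟨hb, -, -, h6, -⟩
      simp [Expr.eval, h6, hb.sq_eq]
    · rintro p s' hp ⟨hb, h3, hσ, h6, h7, h8⟩
      obtain ⟨x, y, hx, hy, htake⟩ := take_succ_pairs hp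
      have hdm := Nat.div_add_mod p n
      have hn : 0 < n := x.pos
      have hmod := Nat.mod_lt p hn
      refine Runs.seq (runs_stepProg hk hb h3 hσ (x := x) (y := y) ?_ (h7.trans hx.symm)
        (h8.trans hy.symm)) (B₂ := 20) ?_ (by omega)
      · rw [h6, hx, hy, mul_comm]; exact hdm.symm
      rintro s₂ ⟨hb₂, h3₂, hσ₂, hv⟩
      have g6 := (hv 6 (by simp)).trans h6
      have g7 := (hv 7 (by simp)).trans h7
      have g8 := (hv 8 (by simp)).trans h8
      rw [htake, pass_concat]
      refine Runs.assign_seq (B₁ := 16) (Runs.assign_seq (B₁ := 12) (Runs.cond (B₁ := 6)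
        (fun hne => ?_) (fun hz => ?_) ?_) ?_) ?_
      · have hlast : p % n + 1 = n := by
          by_contra hcon
          simp [Expr.eval, g8, hb₂.n_eq, hcon] at hne
        have hp1 : p + 1 = n * (p / n + 1) := by rw [mul_add, mul_one]; omega
        refine Runs.assign_seq (B₁ := 4) (Runs.assign (by simp [Expr.cost]) ⟨?_, h3₂, ?_, ?_⟩)
          (by simp [Expr.cost])
        · exact (((hb₂.setVar (by omega) _).setVar (by omega) _).setVar (by omega) _).setVar
            (by omega) _
        · exact (((hσ₂.setVar (by omega) _).setVar (by omega) _).setVar (by omega) _).setVar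
            (by omega) _
        · rw [hp1, Nat.mul_div_cancel_left _ hn, Nat.mul_mod_right, ← hp1]
          simp [Expr.eval, g6, g7]
      · have hlast : p % n + 1 ≠ n := by
          intro hcon
          simp [Expr.eval, g8, hb₂.n_eq, hcon] at hz
        have hp1 : p + 1 = n * (p / n) + (p % n + 1) := by omega
        have hlt : p % n + 1 < n := by omega
        refine Runs.skip (by omega) ⟨?_, h3₂, ?_, ?_⟩
        · exact (hb₂.setVar (by omega) _).setVar (by omega) _
        · exact (hσ₂.setVar (by omega) _).setVar (by omega) _
        · have e₁ : (p + 1) / n = p / n := by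
            rw [hp1, Nat.mul_add_div hn, Nat.div_eq_of_lt hlt, add_zero]
          have e₂ : (p + 1) % n = p % n + 1 := by
            rw [hp1, Nat.mul_add_mod, Nat.mod_eq_of_lt hlt]
          simp [Expr.eval, g6, g7, g8, e₁, e₂]
      all_goals simp [Expr.cost]
    · rintro s' ⟨hb, h3, hσ, -⟩
      rw [List.take_of_length_le (length_pairs n).le] at hσ
      exact ⟨hb, h3, hσ⟩
    · simp only [Expr.cost]
      ring_nf
      omega
  · simp only [Expr.cost]
    ring_nf
    omega
  · simp only [Expr.cost]
    omega

/-- The string `D` of digits to the base `K` may need a carry at the position `i`: the digit there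
may be `K`, the other digits are smaller than `K`, and those after it are `0`. -/
structure IsPending (K : ℕ) (D : ℕ → ℕ) (i : ℕ) : Prop where
  le : D i ≤ K
  lt : ∀ j, j ≠ i → D j < K
  zero : ∀ j, i < j → D j = 0

lemma runs_advanceProg (hK : 0 < K) (hs : Base G k K s) (hD : s.arr 3 = D)
    (hlt : ∀ j, D j < K) (hz : ∀ j, n * n < j → D j = 0) {i : ℕ} (hi : s.var 4 = i)
    (hin : i ≤ n * n) :
    Runs advanceProg s (40 * (n * n) + 60) (fun s' => Base G k K s' ∧
      s'.var 5 = s.var 5 ∧ (∃ i' ≤ i, IsPending K (s'.arr 3) i' ∧ (0 < i' → s'.arr 3 i' ≠ K)) ∧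
      ∃ D' : ℕ → ℕ, (∀ j < i, D' j = D j) ∧ D' i = D i + 1 ∧ (∀ j, i < j → D' j = 0) ∧
        ∀ T, i < T → digitValue K (s'.arr 3) T = digitValue K D' T) := by
  refine Runs.store_seq (B₁ := 40 * (n * n) + 54) (Runs.assign_seq (B₁ := 40 * (n * n) + 50)
    (Runs.seq (Runs.forLoop (B := 7) (n * n - i) (I := fun p s' => Base G k K s' ∧
      s'.var 4 = i ∧ s'.var 5 = s.var 5 ∧ s'.var 6 = i + 1 + p ∧ (∀ j < i, s'.arr 3 j = D j) ∧
      s'.arr 3 i = D i + 1 ∧ (∀ j, i < j → (j < i + 1 + p ∨ n * n < j) → s'.arr 3 j = 0))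
      ?_ ?_ ?_) (fun s₁ hs₁ => ?_) (B₂ := 24 * (n * n) + 30) ?_) ?_) ?_
  · refine ⟨(hs.setArr (by omega) (by omega) _ _).setVar (by omega) _, by simp [hi], by simp,
      by simp [Expr.eval, hi], fun j hj => ?_, ?_, fun j hj hj' => ?_⟩
    · simp [Expr.eval, hi, hD, Function.update_of_ne hj.ne]
    · simp [Expr.eval, hi, hD]
    · simp only [Expr.eval, hi, State.setVar_arr, State.setArr_arr, if_true, hD,
        Function.update_of_ne hj.ne']
      exact hz j (by omega)
  · rintro p s' hp ⟨hb, -, -, h6, -⟩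
    simp only [Expr.eval, h6, hb.sq_eq]
    split_ifs <;> simp <;> omega
  · rintro p s' - ⟨hb, h4, h5, h6, h₁, h₂, h₃⟩
    refine Runs.store_seq (B₁ := 4) (Runs.assign (by simp [Expr.cost])
      ⟨(hb.setArr (by omega) (by omega) _ _).setVar (by omega) _, by simpa using h4,
        by simpa using h5, by simp [Expr.eval, h6]; omega, fun j hj => ?_, ?_, fun j hj hj' => ?_⟩)
      (by simp [Expr.cost])
    all_goals simp only [Expr.eval, h6, State.setVar_arr, State.setArr_arr, if_true,
      Function.update_apply]
    · rw [if_neg (by omega), h₁ j hj]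
    · rw [if_neg (by omega), h₂]
    · split_ifs
      · rfl
      · exact h₃ j hj (by omega)
  · obtain ⟨hb, h4, h5, -, h₁, h₂, h₃⟩ := hs₁
    have h₃' : ∀ j, i < j → s₁.arr 3 j = 0 := fun j hj => h₃ j hj (by omega)
    refine ((Runs.loop (B := 13) (r := i) (I := fun r s' => Base G k K s' ∧
      s'.var 5 = s.var 5 ∧ s'.var 4 = r ∧ r ≤ i ∧ IsPending K (s'.arr 3) r ∧
      ∀ T, i < T → digitValue K (s'.arr 3) T = digitValue K (s₁.arr 3) T) ?_ ?_).mono ?_ ?_)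
    · refine ⟨hb, h5, h4, le_rfl, ⟨?_, fun j hj => ?_, h₃'⟩, fun _ _ => rfl⟩
      · rw [h₂]; exact hlt i
      · rcases lt_or_gt_of_ne hj with hj | hj
        · rw [h₁ j hj]; exact hlt j
        · rw [h₃' j hj]; exact hK
    · rintro r s' ⟨hb', h5', h4', hri, hpend, hval⟩ hne
      have hcarry : 0 < r ∧ s'.arr 3 r = K := by
        simp only [Expr.eval, h4', hb'.base_eq] at hne
        grind
      obtain ⟨a, rfl⟩ : ∃ a, r = a + 1 := ⟨r - 1, by omega⟩
      refine Runs.store_seq (B₁ := 10) (Runs.assign_seq (B₁ := 6) (Runs.store ?_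
        ⟨a, by omega, ?_, ?_, ?_, by omega, ⟨?_, fun j hj => ?_, fun j hj => ?_⟩,
          fun T hT => ?_⟩) ?_) ?_
      · simp [Expr.cost]
      · exact ((hb'.setArr (by omega) (by omega) _ _).setVar (by omega) _).setArr
          (by omega) (by omega) _ _
      · simpa using h5'
      · simp [Expr.eval, h4']
      · have := hpend.lt a (by omega)
        simpa [Expr.eval, h4'] using this
      · have := hpend.lt j
        simp only [Expr.eval, h4', State.setVar_arr, State.setVar_var, State.setArr_arr,
          State.setArr_var, if_true, Nat.add_sub_cancel, Function.update_apply, if_neg hj]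
        split_ifs with h
        · exact hK
        · exact this h
      · have := hpend.zero j
        simp only [Expr.eval, h4', State.setVar_arr, State.setVar_var, State.setArr_arr,
          State.setArr_var, if_true, Nat.add_sub_cancel, Function.update_apply, if_neg hj.ne']
        split_ifs with h
        · rfl
        · exact this (by omega)
      · rw [← hval T hT]
        refine digitValue_carry (i := a) (by omega) hcarry.2 ?_ ?_ fun j hj hj' => ?_ <;>
          simp [Expr.eval, *]
      all_goals simp [Expr.cost]
    · simp only [Expr.cost]
      omega
    · rintro s' ⟨hzero, r, hb', h5', h4', hri, hpend, hval⟩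
      refine ⟨hb', h5', ⟨r, hri, hpend, fun hr hcon => ?_⟩, s₁.arr 3, h₁, h₂, h₃', hval⟩
      simp [Expr.eval, h4', hb'.base_eq, hr, hcon] at hzero
  · simp only [Expr.cost]
    omega
  all_goals simp [Expr.cost]; omega

end

/-! ### The search through all strings of digits -/

/-- The program that repeats passes, with one string of digits after another, until a pass succeeds
or the strings are exhausted, in which case the first digit has reached the base. -/
def searchLoop : Prog :=
  .loop (.lt (.var 5) (.lt (.arr 3 (.const 0)) (.var 3)))
    (.seq passProg (.cond (.var 5) .skip advanceProg))

lemma IsPending.lt_or_eq {K : ℕ} {D : ℕ → ℕ} {i : ℕ} (h : IsPending K D i)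
    (hi : 0 < i → D i ≠ K) : (∀ j, D j < K) ∨ D 0 = K ∧ ∀ j, 1 ≤ j → D j = 0 := by
  have hle := h.le
  by_cases hD : D i = K
  · obtain rfl : i = 0 := by
      by_contra hcon
      exact hi (by omega) hD
    exact .inr ⟨hD, fun j hj => h.zero j hj⟩
  · refine .inl fun j => ?_
    by_cases hj : j = i
    · subst hj; omega
    · exact h.lt j hj

lemma digitValue_lt_pow {K : ℕ} {D : ℕ → ℕ} (h : ∀ j, D j < K) (T : ℕ) :
    digitValue K D T < K ^ T := by
  simpa [digitValue] using digitValue_lt h 0 T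

lemma digitValue_eq_pow {K : ℕ} {D : ℕ → ℕ} (h : D 0 = K) (h' : ∀ j, 1 ≤ j → D j = 0) (T : ℕ) :
    digitValue K D (T + 1) = K ^ (T + 1) := by
  rw [add_comm T 1, digitValue_of_zero h' T, digitValue, digitValue, h]
  ring

section

variable {n : ℕ} {G : SimpleGraph (Fin n)} {k K : ℕ} {s : State}

/-- The digits consumed by a pass are fewer than `β k + 1`, so that the strings of this length
suffice, and there are `K ^ (β k + 1)` of them. Their values increase from pass to pass. -/
lemma runs_searchLoop (hk : k ≤ n * n) (hK : 0 < K) (hs : Base G k K s) (h5 : s.var 5 = 0)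
    (h3 : s.arr 3 = fun _ => 0) :
    Runs searchLoop s (K ^ (G.cliqueNum * k + 1) *
        (12 * (k * n) + n * n * (26 * k + 44 * n + 230) + 40 * (n * n) + 110) + 10) (fun s' =>
      (s'.var 5 = 0 ∧ ¬ ∃ E : ℕ → ℕ, (∀ j, E j < K) ∧ (pass G k E (pairs n)).ok = true) ∨
      ∃ σ, (∃ D, σ = pass G k D (pairs n)) ∧ s'.var 5 = 1 ∧ σ.ok = true ∧ s'.var 1 = k ∧
        Shows k σ s') := by
  set T := G.cliqueNum * k + 1 with hT
  refine Runs.mono (Runs.loop (r := K ^ T)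
    (B := 12 * (k * n) + n * n * (26 * k + 44 * n + 230) + 40 * (n * n) + 100)
    (I := fun r s' => Base G k K s' ∧
      ((s'.var 5 = 0 ∧ (∃ i ≤ n * n, IsPending K (s'.arr 3) i ∧ (0 < i → s'.arr 3 i ≠ K)) ∧
          r + digitValue K (s'.arr 3) T = K ^ T ∧
          ∀ E : ℕ → ℕ, (∀ j, E j < K) → (pass G k E (pairs n)).ok = true →
            digitValue K (s'.arr 3) T ≤ digitValue K E T) ∨
        ∃ σ, (∃ D, σ = pass G k D (pairs n)) ∧ s'.var 5 = 1 ∧ σ.ok = true ∧ Shows k σ s'))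
    ?_ ?_) ?_ ?_
  · have hzero : digitValue K (s.arr 3) T = 0 := by
      simpa [digitValue] using digitValue_of_zero (K := K) (D := s.arr 3) (a := 0) (by simp [h3]) T
    refine ⟨hs, .inl ⟨h5, ⟨0, by omega, ⟨by simp [h3], by simp [h3, hK], by simp [h3]⟩,
      by simp⟩, by omega, fun E _ _ => by omega⟩⟩
  · rintro r s₁ ⟨hb, h⟩ hne
    have htest : s₁.var 5 = 0 ∧ s₁.arr 3 0 < K := by
      simp only [Expr.eval, hb.base_eq] at hne
      grind
    rcases h with ⟨-, ⟨i', hi'n, hpend, hi'⟩, hr, hE⟩ | ⟨σ, -, h, -⟩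
    swap
    · omega
    have hlt : ∀ j, s₁.arr 3 j < K :=
      (hpend.lt_or_eq hi').resolve_right fun h => by omega
    have hval := digitValue_lt_pow hlt T
    set D := s₁.arr 3 with hD
    set σ := pass G k D (pairs n) with hσ
    have hi : σ.i ≤ n * n := (pass_i_le_length _).trans (length_pairs n).le
    have hiT : σ.i < T := Nat.lt_succ_of_le (pass_i_le_cliqueNum_mul _)
    refine Runs.seq (runs_passProg hk hb hD.symm) (B₂ := 40 * (n * n) + 65)
      (fun s₂ ⟨hb₂, h3₂, hσ₂⟩ => ?_) (by omega)
    refine Runs.cond (B₁ := 40 * (n * n) + 60) (fun hok => ?_) (fun hfail => ?_)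
      (by simp [Expr.cost]; omega)
    · have hok' : σ.ok = true := by
        by_contra hcon
        simp [Expr.eval, hσ₂.ok_eq, ← hσ, hcon] at hok
      refine Runs.skip (by omega) ⟨0, by omega, hb₂, .inr ⟨σ, ⟨D, rfl⟩, ?_, hok', hσ₂⟩⟩
      simp [hσ₂.ok_eq, ← hσ, hok']
    · have hfail' : σ.ok = false := by
        by_contra hcon
        simp [Expr.eval, hσ₂.ok_eq, ← hσ, hcon] at hfail
      refine (runs_advanceProg hK hb₂ h3₂ hlt (fun j hj => hpend.zero j (by omega)) hσ₂.i_eq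
        hi).mono le_rfl ?_
      rintro s₃ ⟨hb₃, h5₃, ⟨i'', hi'', hpend', hne'⟩, D', hlt', heq', hgt', hval'⟩
      have hv := hval' T hiT
      have hinc := digitValue_lt_increment hiT hlt' heq' hgt' hlt
      have hbound : digitValue K (s₃.arr 3) T ≤ K ^ T := by
        rcases hpend'.lt_or_eq hne' with h | ⟨h, h'⟩
        · exact (digitValue_lt_pow h T).le
        · exact (digitValue_eq_pow h h' _).le
      refine ⟨K ^ T - digitValue K (s₃.arr 3) T, by omega, hb₃, .inl ⟨?_, ⟨i'', hi''.trans hi,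
        hpend', hne'⟩, by omega, fun E hEK hEok => ?_⟩⟩
      · exact h5₃.trans (by simpa [Expr.eval] using hfail)
      · rw [hv]
        refine digitValue_increment_le hiT hlt' heq' hgt' hlt hEK (hE E hEK hEok) ?_
        by_contra hcon
        push Not at hcon
        rw [pass_congr (fun j hj => hcon j hj.le) (fun _ => hcon _ le_rfl)] at hEok
        exact absurd hEok (by simp [← hσ, hfail'])
  · simp only [Expr.cost]
    exact Nat.add_le_add (Nat.mul_le_mul_left _ (by omega)) (by omega)
  · rintro s₁ ⟨hz, r, hb, ⟨h5₁, ⟨i', -, hpend, hi'⟩, -, hE⟩ | ⟨σ, hσ, h5₁, hok, hsh⟩⟩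
    · refine .inl ⟨h5₁, ?_⟩
      rintro ⟨E, hEK, hEok⟩
      have hnlt : ¬ s₁.arr 3 0 < K := by
        intro hcon
        simp [Expr.eval, h5₁, hb.base_eq, hcon] at hz
      obtain ⟨h, h'⟩ := (hpend.lt_or_eq hi').resolve_left fun h => hnlt (h 0)
      have := hE E hEK hEok
      rw [digitValue_eq_pow h h'] at this
      exact absurd (digitValue_lt_pow hEK T) (not_lt.2 this)
    · exact .inr ⟨σ, hσ, h5₁, hok, hb.k_eq, hsh⟩

/-! ### The whole program -/

/-- The preparations: register `2` receives `n * n`, register `1` the minimum of `k` and `n * n`,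
array `2` the multiples of `n`, and register `3` the base of the digits, which has to be
positive. -/
def prepareProg : Prog :=
  .seq (.loop (.lt (.var 3) (.var 0))
      (.seq (.assign 2 (.add (.var 2) (.var 0))) (.assign 3 (.add (.var 3) (.const 1)))))
    (.seq (.cond (.lt (.var 2) (.var 1)) (.assign 1 (.var 2)) .skip)
      (.seq (.loop (.lt (.var 4) (.var 2))
          (.seq (.store 2 (.add (.var 4) (.const 1)) (.add (.arr 2 (.var 4)) (.var 0)))
            (.assign 4 (.add (.var 4) (.const 1)))))
        (.assign 3 (.add (.var 1) (.eq (.var 1) (.const 0))))))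

lemma input_arr_zero (G : SimpleGraph (Fin n)) (k : ℕ) (x y : Fin n) [Decidable (G.Adj x y)] :
    (input G k).arr 0 ((x : ℕ) * n + (y : ℕ)) = if G.Adj x y then 1 else 0 := by
  have h : (∃ i j : Fin n, (x : ℕ) * n + (y : ℕ) = (i : ℕ) * n + (j : ℕ) ∧ G.Adj i j) ↔
      G.Adj x y := by
    refine ⟨?_, fun h => ⟨x, y, rfl, h⟩⟩
    rintro ⟨i, j, hij, hadj⟩
    obtain ⟨h₁, rfl⟩ := mul_add_inj hij
    obtain rfl := Fin.ext h₁
    exact hadj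
  simp only [input, h, true_and]

lemma runs_prepareProg (G : SimpleGraph (Fin n)) (k : ℕ) :
    Runs prepareProg (input G k) (12 * n + 20 * (n * n) + 40) (fun s =>
      Base G (min k (n * n)) (max (min k (n * n)) 1) s ∧ s.var 5 = 0 ∧
        s.arr 3 = fun _ => 0) := by
  classical
  refine Runs.seq (Runs.forLoop (B := 8) n (I := fun p s => s.var 0 = n ∧ s.var 1 = k ∧
    s.var 2 = p * n ∧ s.var 3 = p ∧ s.var 4 = 0 ∧ s.var 5 = 0 ∧ s.arr = (input G k).arr)
    ?_ ?_ ?_) (B₂ := 20 * (n * n) + 30) ?_ ?_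
  · simp [input]
  · rintro p s - ⟨h0, -, -, h3, -⟩
    simp [Expr.eval, h0, h3]
  · rintro p s - ⟨h0, h1, h2, h3, h4, h5, ha⟩
    refine Runs.assign_seq (B₁ := 4) (Runs.assign (by simp [Expr.cost]) ?_) (by simp [Expr.cost])
    simp [Expr.eval, h0, h1, h2, h3, h4, h5, ha, add_mul]
  · rintro s ⟨h0, h1, h2, -, h4, h5, ha⟩
    refine Runs.seq (R := fun s' => s' = s.setVar 1 (min k (n * n)) ) (B₁ := 6)
      (B₂ := 20 * (n * n) + 24) (Runs.cond (B₁ := 2) (fun hne => ?_) (fun hz => ?_) ?_) ?_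
      (by omega)
    · refine Runs.assign (by simp [Expr.cost]) ?_
      simp only [Expr.eval, h1, h2] at hne ⊢
      rw [min_eq_right]
      grind
    · refine Runs.skip (by omega) ?_
      have : min k (n * n) = s.var 1 := by
        simp only [Expr.eval, h1, h2] at hz
        rw [h1, min_eq_left]
        grind
      simp [this, State.setVar]
    · simp [Expr.cost]
    rintro _ rfl
    refine Runs.seq (Runs.forLoop (B := 12) (n * n) (I := fun p s => s.var 0 = n ∧
      s.var 1 = min k (n * n) ∧ s.var 2 = n * n ∧ s.var 4 = p ∧ s.var 5 = 0 ∧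
      s.arr 0 = (input G k).arr 0 ∧ (∀ j ≤ p, s.arr 2 j = j * n) ∧ s.arr 3 = fun _ => 0)
      ?_ ?_ ?_) (fun s₁ hs₁ => Runs.assign le_rfl ?_) ?_
    · simp [h0, h2, h4, h5, ha, input]
    · rintro p s' - ⟨-, -, g2, g4, -⟩
      simp [Expr.eval, g2, g4]
    · rintro p s' - ⟨g0, g1, g2, g4, g5, ga, gm, gd⟩
      refine Runs.store_seq (B₁ := 4) (Runs.assign (by simp [Expr.cost]) ⟨by simpa using g0,
        by simpa using g1, by simpa using g2, by simp [Expr.eval, g4], by simpa using g5,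
        by simpa using ga, fun j hj => ?_, by simpa using gd⟩) (by simp [Expr.cost])
      simp only [Expr.eval, g4, g0, gm p le_rfl, State.setVar_arr, State.setArr_arr, if_true,
        Function.update_apply]
      split_ifs with hjp
      · rw [hjp, add_mul, one_mul]
      · exact gm j (by omega)
    · obtain ⟨g0, g1, g2, g4, g5, ga, gm, gd⟩ := hs₁
      refine ⟨⟨by simp [g0], by simp [g1], by simp [g2], ?_, fun x y => ?_, by simpa using gm⟩,
        by simp [g5], by simpa using gd⟩
      · simp only [State.setVar_var, if_true, Expr.eval, g1]
        grind
      · simp only [State.setVar_arr, ga]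
        exact input_arr_zero G k x y
    · simp [Expr.cost]
      omega
  · simp only [Expr.cost]
    omega

/-- The program for Edge Clique Cover. -/
def eccProg : Prog := .seq prepareProg (.seq searchLoop (.assign 0 (.var 5)))

/-- If there is a solution, then there is one with at most `n * n` cliques, since the edges
themselves form a solution. -/
lemma IsSolution.exists_family {𝒞 : Finset (Finset (Fin n))} (h : IsSolution G k 𝒞) :
    ∃ S : ℕ → Finset (Fin n), (∀ l < min k (n * n), G.IsClique (S l : Set (Fin n))) ∧
      ∀ x y, G.Adj x y → ∃ l < min k (n * n), x ∈ S l ∧ y ∈ S l := by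
  classical
  suffices ∃ L : List (Finset (Fin n)), L.length ≤ min k (n * n) ∧
      (∀ C ∈ L, G.IsClique (C : Set (Fin n))) ∧
      ∀ x y, G.Adj x y → ∃ C ∈ L, x ∈ C ∧ y ∈ C by
    obtain ⟨L, hlen, hcl, hcov⟩ := this
    refine ⟨fun l => L.getD l ∅, fun l _ => ?_, fun x y hxy => ?_⟩
    · dsimp only
      by_cases hl : l < L.length
      · rw [List.getD_eq_getElem _ _ hl]
        exact hcl _ (List.getElem_mem hl)
      · rw [List.getD_eq_default _ _ (by omega)]
        simp
    · obtain ⟨C, hC, hx, hy⟩ := hcov x y hxy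
      obtain ⟨l, hl, rfl⟩ := List.getElem_of_mem hC
      refine ⟨l, by omega, ?_⟩
      dsimp only
      rw [List.getD_eq_getElem _ _ hl]
      exact ⟨hx, hy⟩
  rcases le_total k (n * n) with hk | hk
  · refine ⟨𝒞.toList, ?_, by simpa using h.2.1, by simpa using h.2.2⟩
    rw [min_eq_left hk, Finset.length_toList]
    exact h.1
  · refine ⟨((pairs n).filter fun e => G.Adj e.1 e.2).map fun e => {e.1, e.2}, ?_, ?_, ?_⟩
    · rw [min_eq_right hk, List.length_map]
      exact (List.length_filter_le _ _).trans (length_pairs n).le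
    · intro C hC
      obtain ⟨e, he, rfl⟩ := List.mem_map.1 hC
      have hadj : G.Adj e.1 e.2 := by simpa using (List.mem_filter.1 he).2
      simpa [SimpleGraph.isClique_pair] using fun _ => hadj
    · intro x y hxy
      exact ⟨{x, y}, List.mem_map.2 ⟨(x, y), List.mem_filter.2 ⟨mem_pairs _, by simpa⟩, rfl⟩,
        by simp, by simp⟩

lemma isSolution_of_pass_ok {k' : ℕ} (hk : k ≤ k') {D : ℕ → ℕ}
    (h : (pass G k D (pairs n)).ok = true) :
    IsSolution G k' ((Finset.range k).image (pass G k D (pairs n)).C) := by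
  refine ⟨Finset.card_image_le.trans (by simpa using hk), fun C hC => ?_, fun x y hxy => ?_⟩
  · obtain ⟨l, -, rfl⟩ := Finset.mem_image.1 hC
    exact pass_isClique _ l
  · obtain ⟨l, hl, hx, hy⟩ := exists_mem_of_pass_ok h (x, y) (mem_pairs _) hxy
    exact ⟨_, Finset.mem_image.2 ⟨l, Finset.mem_range.2 hl, rfl⟩, hx, hy⟩

lemma runs_eccProg (G : SimpleGraph (Fin n)) (k : ℕ) :
    Runs eccProg (input G k)
      (max (min k (n * n)) 1 ^ (G.cliqueNum * min k (n * n) + 1) * (12 * (min k (n * n) * n) +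
        n * n * (26 * min k (n * n) + 44 * n + 230) + 40 * (n * n) + 110) +
        (12 * n + 20 * (n * n) + 60))
      (fun s => IsCorrect G k (output n s)) := by
  refine Runs.seq (runs_prepareProg G k) (fun s ⟨hb, h5, h3⟩ => Runs.seq
    (runs_searchLoop (min_le_right _ _) (by omega) hb h5 h3) (fun s₁ hs₁ => ?_) (B₂ := 2) le_rfl)
    (by omega)
  refine Runs.assign (by simp [Expr.cost]) ?_
  rcases hs₁ with ⟨h0, hno⟩ | ⟨σ, ⟨D, hσ⟩, h0, hok, h1, hsh⟩
  · simp only [output, State.setVar_var, if_true, Expr.eval, h0, IsCorrect]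
    rintro ⟨𝒞, h𝒞⟩
    obtain ⟨S, hS, hcov⟩ := h𝒞.exists_family
    exact hno (exists_pass_ok (by omega) (le_max_left _ _) hS hcov (pairs n))
  · have hout : output n (s₁.setVar 0 (Expr.eval s₁ (.var 5))) =
        some ((Finset.range (min k (n * n))).image σ.C) := by
      simp only [output, State.setVar_var, State.setVar_arr, if_true, Expr.eval, h0, h1,
        one_ne_zero, if_false]
      congr 1
      refine Finset.image_congr fun l hl => ?_
      ext v
      simp [hsh.inc_eq l (by simpa using hl) v]
    rw [hout]
    subst hσ
    exact isSolution_of_pass_ok (min_le_left _ _) hok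

end

lemma pow_le_two_rpow (β : ℕ) {k k' : ℕ} (hk : k' ≤ k) :
    ((max k' 1 ^ (β * k') : ℕ) : ℝ) ≤ (2 : ℝ) ^ ((β : ℝ) * (k : ℝ) * Real.logb 2 (k : ℝ)) := by
  rcases Nat.eq_zero_or_pos k with rfl | hpos
  · obtain rfl : k' = 0 := by omega
    simp
  · have hR : (0 : ℝ) < k := by exact_mod_cast hpos
    have h : (2 : ℝ) ^ ((β : ℝ) * (k : ℝ) * Real.logb 2 (k : ℝ)) = ((k ^ (β * k) : ℕ) : ℝ) := by
      rw [mul_comm, Real.rpow_mul (by norm_num), Real.rpow_logb (by norm_num) (by norm_num) hR,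
        ← Nat.cast_mul, Real.rpow_natCast, Nat.cast_pow]
    rw [h, Nat.cast_le]
    calc max k' 1 ^ (β * k') ≤ k ^ (β * k') := Nat.pow_le_pow_left (by omega) _
      _ ≤ k ^ (β * k) := Nat.pow_le_pow_right hpos (Nat.mul_le_mul_left _ hk)

/-- The number of steps, apart from the number of strings of `β k` digits, is polynomial in `n`. -/
lemma steps_le {n k X Y : ℕ} (hk : k ≤ n * n) (hX : 1 ≤ X) (hY : Y = X * max k 1) :
    Y * (12 * (k * n) + n * n * (26 * k + 44 * n + 230) + 40 * (n * n) + 110) +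
      (12 * n + 20 * (n * n) + 60) ≤ X * (1000 * (n + 1) ^ 6) := by
  set N := n + 1 with hN
  have h1 : 1 ≤ N := by omega
  have hn : n ≤ N := by omega
  have hnn : n * n ≤ N ^ 2 := by rw [pow_two]; gcongr
  have hkN : k ≤ N ^ 2 := hk.trans hnn
  have hK : max k 1 ≤ N ^ 2 := max_le hkN (Nat.one_le_pow _ _ h1)
  have h12 : N ≤ N ^ 2 := Nat.le_self_pow (by omega) N
  have h01 : 1 ≤ N ^ 2 := Nat.one_le_pow _ _ h1
  have h24 : N ^ 2 ≤ N ^ 4 := Nat.pow_le_pow_right h1 (by omega)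
  have h46 : N ^ 4 ≤ N ^ 6 := Nat.pow_le_pow_right h1 (by omega)
  have hkn : k * n ≤ N ^ 4 := by
    calc k * n ≤ N ^ 2 * N ^ 2 := by gcongr; omega
      _ = N ^ 4 := by ring
  have hcube : n * n * (26 * k + 44 * n + 230) ≤ 300 * N ^ 4 := by
    calc n * n * (26 * k + 44 * n + 230) ≤ N ^ 2 * (300 * N ^ 2) := by gcongr; omega
      _ = 300 * N ^ 4 := by ring
  have hbody : 12 * (k * n) + n * n * (26 * k + 44 * n + 230) + 40 * (n * n) + 110 ≤
      500 * N ^ 4 := by omega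
  have hmain : Y * (12 * (k * n) + n * n * (26 * k + 44 * n + 230) + 40 * (n * n) + 110) ≤
      X * (500 * N ^ 6) := by
    calc _ ≤ X * N ^ 2 * (500 * N ^ 4) := by rw [hY]; gcongr
      _ = X * (500 * N ^ 6) := by ring
  have hrest : 12 * n + 20 * (n * n) + 60 ≤ X * (500 * N ^ 6) := by
    calc 12 * n + 20 * (n * n) + 60 ≤ 500 * N ^ 6 := by omega
      _ ≤ X * (500 * N ^ 6) := Nat.le_mul_of_pos_left _ hX
  calc _ ≤ X * (500 * N ^ 6) + X * (500 * N ^ 6) := Nat.add_le_add hmain hrest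
    _ = X * (1000 * N ^ 6) := by ring

end ECC

theorem theorem2 :
    (∃ (P : ECC.Prog) (c : ℕ), ∀ (n : ℕ) (G : SimpleGraph (Fin n)) (k : ℕ),
      ∃ (t : ℕ) (s : ECC.State),
        ECC.Exec P (ECC.input G k) t s ∧
        ECC.IsCorrect G k (ECC.output n s) ∧
        (t : ℝ) ≤ (2 : ℝ) ^ ((G.cliqueNum : ℝ) * (k : ℝ) * Real.logb 2 (k : ℝ)) *
          ((c : ℝ) * ((n : ℝ) + 1) ^ c)) ∧
    (∀ (n : ℕ) (G : SimpleGraph (Fin n)) (k : ℕ) (u : Fin n ≃ Fin n)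
      (π : List (Fin n × Fin n)),
      ECC.IsDegeneracyOrdering G u → ECC.IsDEP G u π →
        (∀ (h : ℕ) (ν : ECC.Node (Fin n)), ECC.InTree G π k h ν →
          h ≤ G.cliqueNum * k ∧
          (ν.branches G π).length ≤ k ∧
          (ν.IsSuccess G → ECC.IsSolution G k ν.cliques.toFinset)) ∧
        ((∃ 𝒞 : Finset (Finset (Fin n)), ECC.IsSolution G k 𝒞) →
          ∃ (h : ℕ) (ν : ECC.Node (Fin n)), ECC.InTree G π k h ν ∧ ν.IsSuccess G)) := by
  refine ⟨⟨ECC.eccProg, 1000, fun n G k => ?_⟩, fun n G k u π _ hπ => ⟨fun h ν hν => ?_, ?_⟩⟩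
  · obtain ⟨t, s, hexec, ht, hcorrect⟩ := ECC.runs_eccProg G k
    refine ⟨t, s, hexec, hcorrect, ?_⟩
    have hle := ht.trans (ECC.steps_le (X := max (min k (n * n)) 1 ^ (G.cliqueNum * min k (n * n)))
      (min_le_right _ _) (Nat.one_le_pow _ _ (by omega)) (pow_succ _ _))
    calc (t : ℝ) ≤ ((max (min k (n * n)) 1 ^ (G.cliqueNum * min k (n * n)) : ℕ) : ℝ) *
          ((1000 : ℕ) * ((n : ℝ) + 1) ^ 6) := by exact_mod_cast hle
      _ ≤ _ := by
        gcongr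
        · exact ECC.pow_le_two_rpow _ (min_le_left _ _)
        · linarith [n.cast_nonneg (α := ℝ)]
        · norm_num
  · obtain ⟨-, hlen, -⟩ := hν.invariant hπ
    exact ⟨hν.depth_le hπ, ECC.Node.length_branches_le.trans hlen.le, hν.isSolution hπ⟩
  · rintro ⟨𝒞, h𝒞⟩
    exact ECC.InTree.exists_isSuccess hπ h𝒞
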